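/- Let $T^n=\mathbb{R}^n/\mathbb{Z}^n$, where $n\ge 0$. A $k$-dimensional toric subspace of $T^n$ is the image of a $k$-dimensional affine subspace $\{v\in\mathbb{R}^n : Av=b\}$, where $A$ has rational entries and $b$ has real entries; a toric hyperplane is an $(n-1)$-dimensional toric subspace. A toric hyperplane arrangement $\mathcal{H}$ is a finite collection of toric hyperplanes in $T^n$, and its regions are the connected components of $T^n\setminus\bigcup_{H\in\mathcal{H}}H$. Its intersection poset $\mathcal{P}$ consists of the empty set together with all connected components of all intersections $\bigcap_{H\in S}H$, $S\subseteq\mathcal{H}$ (the empty intersection being $T^n$), ordered by reverse inclusion; its minimal element is $\hat 0=T^n$ and its maximal element is $\hat 1=\emptyset$. Let $\mu$ be the Möbius function of $\mathcal{P}$ and let $$\chi(\mathcal{H};t)=\sum_{x\in\mathcal{P},\ x\neq\emptyset}\mu(\hat 0,x)\,t^{\dim(x)}$$ be the toric characteristic polynomial. For a finite graded poset $P$ with $\hat 0$ and $\hat 1$, and rank function $\rho$, let $$Z_t(P)=\sum_{x\text{ coatom of }P}(-1)^{\rho(\hat 0,x)}\,\mu(\hat 0,x).$$ Theorem. Suppose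 that every region of $\mathcal{H}$ is homeomorphic to an open $n$-dimensional ball. Then the number of regions is finite and equals $$(-1)^n\cdot\chi(\mathcal{H};0).$$ Equivalently, the intersection poset $\mathcal{P}$ is graded and the number of regions equals $Z_t(\mathcal{P})$. -/

import Mathlib

noncomputable section

namespace ToricArr

open Topology

/-- The `n`-dimensional torus `ℝⁿ / ℤⁿ`, as the product of `n` copies of `ℝ / ℤ`. -/
abbrev Torus (n : ℕ) : Type := UnitAddTorus (Fin n)

/-- The quotient map `ℝⁿ → ℝⁿ / ℤⁿ`. -/
def proj {n : ℕ} (v : Fin n → ℝ) : Torus n := fun i => (v i : UnitAddCircle)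

/-- `V` is the solution set of a linear system `A v = b`, where `A` has rational entries and
`b` has real entries. -/
def HasRationalCoefficients {n : ℕ} (V : AffineSubspace ℝ (Fin n → ℝ)) : Prop :=
  ∃ (m : ℕ) (A : Matrix (Fin m) (Fin n) ℚ) (b : Fin m → ℝ),
    ∀ v : Fin n → ℝ, v ∈ V ↔ (A.map (fun q : ℚ => (q : ℝ))).mulVec v = b

/-- `x` is a `k`-dimensional toric subspace: the image in the torus of a (nonempty)
`k`-dimensional affine subspace of `ℝⁿ` with rational coefficients. -/
def IsToricSubspace {n : ℕ} (k : ℕ) (x : Set (Torus n)) : Prop :=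
  ∃ V : AffineSubspace ℝ (Fin n → ℝ), (V : Set (Fin n → ℝ)).Nonempty ∧
    HasRationalCoefficients V ∧ Module.finrank ℝ V.direction = k ∧
    x = proj '' (V : Set (Fin n → ℝ))

/-- A toric hyperplane is a toric subspace of codimension one. -/
def IsToricHyperplane {n : ℕ} (x : Set (Torus n)) : Prop :=
  ∃ k : ℕ, k + 1 = n ∧ IsToricSubspace k x

/-- The dimension of a toric subspace. (A set is a `k`-dimensional toric subspace for at most
one `k`.) -/
def toricDim {n : ℕ} (x : Set (Torus n)) : ℕ := sInf {k : ℕ | IsToricSubspace k x}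

/-- The set of connected components of the subset `K` of a topological space. -/
def components {X : Type*} [TopologicalSpace X] (K : Set X) : Set (Set X) :=
  {c | ∃ p ∈ K, c = connectedComponentIn K p}

end ToricArr

open ToricArr

/-- A toric hyperplane arrangement on the `n`-dimensional torus: a finite collection of toric
hyperplanes. -/
structure ToricArrangement (n : ℕ) where
  hyperplanes : Set (Set (Torus n))
  finite_hyperplanes : hyperplanes.Finite
  isToricHyperplane : ∀ H ∈ hyperplanes, IsToricHyperplane H

namespace ToricArrangement

variable {n : ℕ} (𝓗 : ToricArrangement n)

/-- The complement in the torus of the union of the hyperplanes. -/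
def complement : Set (Torus n) := (⋃₀ 𝓗.hyperplanes)ᶜ

/-- The regions: the connected components of the complement. -/
def regions : Set (Set (Torus n)) := components 𝓗.complement

/-- Every region is homeomorphic to an open `n`-dimensional ball. -/
def RegionsAreOpenBalls : Prop :=
  ∀ R ∈ 𝓗.regions, Nonempty (R ≃ₜ Metric.ball (0 : EuclideanSpace ℝ (Fin n)) 1)

/-- The underlying set of the intersection poset: the connected components of all intersections
of hyperplanes in the arrangement, together with the empty set. The empty intersection is the
whole torus. -/
def flats : Set (Set (Torus n)) :=
  {x | x = ∅ ∨ ∃ S ⊆ 𝓗.hyperplanes, x ∈ components (⋂₀ S)}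

/-- The intersection poset, ordered by reverse inclusion. -/
abbrev IntersectionPoset : Type := (𝓗.flats)ᵒᵈ

/-- The subset of the torus underlying an element of the intersection poset. -/
def toSet {𝓗 : ToricArrangement n} (x : 𝓗.IntersectionPoset) : Set (Torus n) :=
  (OrderDual.ofDual x).1

end ToricArrangement

/-! ### The intersection poset is finite and bounded -/

namespace ToricArr

open Topology

lemma proj_add {n : ℕ} (v w : Fin n → ℝ) : proj (v + w) = proj v + proj w := by
  ext i; simp [proj]

lemma proj_sub {n : ℕ} (v w : Fin n → ℝ) : proj (v - w) = proj v - proj w := by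
  ext i; simp [proj]

lemma continuous_proj {n : ℕ} : Continuous (proj (n := n)) :=
  continuous_pi fun i => (AddCircle.continuous_mk' (1 : ℝ)).comp (continuous_apply i)

lemma isOpenMap_proj {n : ℕ} : IsOpenMap (proj (n := n)) := by
  have h := IsOpenMap.piMap (A := fun _ : Fin n => ℝ) (B := fun _ : Fin n => UnitAddCircle)
    (f := fun _ => ((↑) : ℝ → UnitAddCircle)) (fun _ => QuotientAddGroup.isOpenMap_coe)
    (Filter.Eventually.of_forall fun _ => QuotientAddGroup.mk_surjective)
  exact h

/-- Near any of its points, a toric subspace looks like a linear subspace. -/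
lemma IsToricSubspace.exists_nhds {n k : ℕ} {H : Set (Torus n)} (hH : IsToricSubspace k H) :
    ∃ N ∈ 𝓝 (0 : Fin n → ℝ), ∀ p ∈ H, ∀ u ∈ N, p + proj u ∈ H →
      ∀ t : ℝ, p + proj (t • u) ∈ H := by
  obtain ⟨V, -, ⟨m, A, b, hV⟩, -, rfl⟩ := hH
  set A' : Matrix (Fin m) (Fin n) ℝ := A.map (fun q : ℚ => (q : ℝ)) with hA'
  obtain ⟨D, hD, hDA⟩ : ∃ D : ℕ, 0 < D ∧ ∀ i j, ∃ z : ℤ, (D : ℝ) * A' i j = z := by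
    refine ⟨∏ i, ∏ j, (A i j).den,
      Finset.prod_pos fun i _ => Finset.prod_pos fun j _ => (A i j).den_pos, fun i j => ?_⟩
    obtain ⟨c, hc⟩ : (A i j).den ∣ ∏ i, ∏ j, (A i j).den :=
      (Finset.dvd_prod_of_mem (fun j => (A i j).den) (Finset.mem_univ j)).trans
        (Finset.dvd_prod_of_mem (fun i => ∏ j, (A i j).den) (Finset.mem_univ i))
    refine ⟨c * (A i j).num, ?_⟩
    have h1 : ((A i j).den : ℝ) * ((A i j : ℚ) : ℝ) = ((A i j).num : ℝ) := by
      have := Rat.den_mul_eq_num (A i j)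
      exact_mod_cast this
    rw [hc]
    simp only [hA', Matrix.map_apply]
    push_cast
    rw [← h1]; ring
  have hD' : (0 : ℝ) < D := by exact_mod_cast hD
  refine ⟨{u | ∀ i, |A'.mulVec u i| < 1 / D}, ?_, ?_⟩
  · refine IsOpen.mem_nhds ?_ ?_
    · have : {u : Fin n → ℝ | ∀ i, |A'.mulVec u i| < 1 / D}
          = ⋂ i, {u | |A'.mulVec u i| < 1 / D} := by ext; simp
      rw [this]
      refine isOpen_iInter_of_finite fun i => isOpen_lt ?_ continuous_const
      have : Continuous fun u : Fin n → ℝ => A'.mulVec u := by fun_prop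
      exact ((continuous_apply i).comp this).abs
    · intro i
      simpa using hD
  · rintro _ ⟨v, hv, rfl⟩ u hu ⟨w, hw, hwu⟩ t
    have hv' := (hV v).1 hv
    have hw' := (hV w).1 hw
    have hz : ∀ j, ∃ z : ℤ, (z : ℝ) = (v + u - w) j := by
      intro j
      have h0 : proj (v + u - w) = 0 := by rw [proj_sub, proj_add, hwu, sub_self]
      have h1 : (((v + u - w) j : ℝ) : UnitAddCircle) = 0 := congrFun h0 j
      obtain ⟨z, hz⟩ := (AddCircle.coe_eq_zero_iff (1 : ℝ)).1 h1
      exact ⟨z, by simpa using hz⟩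
    choose z hz using hz
    choose c hc using hDA
    have hAu : A'.mulVec u = 0 := by
      have h2 : A'.mulVec (v + u - w) = A'.mulVec u := by
        rw [Matrix.mulVec_sub, Matrix.mulVec_add, hv', hw']; abel
      funext i
      have h3 : (D : ℝ) * A'.mulVec u i = ((∑ j, c i j * z j : ℤ) : ℝ) := by
        rw [← h2]
        simp only [Matrix.mulVec, dotProduct, Finset.mul_sum]
        push_cast
        refine Finset.sum_congr rfl fun j _ => ?_
        rw [← hz, ← hc]; ring
      have h4 : |((∑ j, c i j * z j : ℤ) : ℝ)| < 1 := by
        rw [← h3, abs_mul, abs_of_pos hD']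
        have := hu i
        rw [lt_div_iff₀ hD'] at this
        linarith
      have h5 : (∑ j, c i j * z j : ℤ) = 0 := by
        rw [← Int.abs_lt_one_iff]
        exact_mod_cast h4
      rw [h5] at h3
      have h6 : A'.mulVec u i = 0 := by
        rcases mul_eq_zero.1 (h3.trans Int.cast_zero) with h | h
        · exact absurd h hD'.ne'
        · exact h
      simpa using h6
    refine ⟨v + t • u, (hV _).2 ?_, proj_add _ _⟩
    rw [Matrix.mulVec_add, Matrix.mulVec_smul, hAu, hv']; simp

lemma finite_components {n : ℕ} {S : Set (Set (Torus n))} (hS : S.Finite)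
    (hT : ∀ H ∈ S, ∃ k, IsToricSubspace k H) : (components (⋂₀ S)).Finite := by
  classical
  set K := ⋂₀ S with hK
  obtain ⟨N, hN, hNK⟩ : ∃ N ∈ 𝓝 (0 : Fin n → ℝ), ∀ p ∈ K, ∀ u ∈ N, p + proj u ∈ K →
      ∀ t : ℝ, p + proj (t • u) ∈ K := by
    have h : ∀ H : S, ∃ N ∈ 𝓝 (0 : Fin n → ℝ), ∀ p ∈ H.1, ∀ u ∈ N, p + proj u ∈ H.1 →
        ∀ t : ℝ, p + proj (t • u) ∈ H.1 := fun H =>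
      let ⟨_, hk⟩ := hT H.1 H.2
      hk.exists_nhds
    choose N hN hN' using h
    have := hS.to_subtype
    refine ⟨⋂ H, N H, Filter.iInter_mem.2 hN, fun p hp u hu hpu t H hH => ?_⟩
    exact hN' ⟨H, hH⟩ p (hp H hH) u (Set.mem_iInter.1 hu _) (hpu H hH) t
  obtain ⟨M, hM, hMN⟩ : ∃ M ∈ 𝓝 (0 : Fin n → ℝ), ∀ x ∈ M, ∀ y ∈ M, y - x ∈ N := by
    have h : Filter.Tendsto (fun q : (Fin n → ℝ) × (Fin n → ℝ) => q.2 - q.1)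
        (𝓝 (0, 0)) (𝓝 0) := by
      have : Continuous fun q : (Fin n → ℝ) × (Fin n → ℝ) => q.2 - q.1 := by fun_prop
      simpa using this.tendsto (0, 0)
    have h' := h hN
    rw [nhds_prod_eq] at h'
    obtain ⟨M, hM, hMs⟩ := Filter.mem_prod_same_iff.1 h'
    exact ⟨M, hM, fun x hx y hy => hMs (Set.mk_mem_prod hx hy)⟩
  have hU : ∀ q : Torus n, (fun x => q + x) '' (proj '' M) ∈ 𝓝 q := fun q => by
    have h1 : proj '' M ∈ 𝓝 (0 : Torus n) := by
      have := isOpenMap_proj.image_mem_nhds hM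
      rwa [show proj (0 : Fin n → ℝ) = 0 by ext; simp [proj]] at this
    have := (Homeomorph.addLeft q).isOpenMap.image_mem_nhds h1
    simpa using this
  obtain ⟨t, -, ht⟩ := isCompact_univ.elim_nhds_subcover _ fun q _ => hU q
  let f : Torus n → Set (Torus n) := fun q =>
    if h : ∃ p ∈ K, p ∈ (fun x => q + x) '' (proj '' M) then connectedComponentIn K h.choose
    else ∅
  refine (t.finite_toSet.image f).subset ?_
  rintro _ ⟨p, hp, rfl⟩
  obtain ⟨q, hq, hpq⟩ := Set.mem_iUnion₂.1 (ht (Set.mem_univ p))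
  refine ⟨q, hq, ?_⟩
  have hex : ∃ p ∈ K, p ∈ (fun x => q + x) '' (proj '' M) := ⟨p, hp, hpq⟩
  simp only [f, dif_pos hex]
  obtain ⟨hp', _, ⟨x, hx, rfl⟩, hx'⟩ := hex.choose_spec
  obtain ⟨_, ⟨y, hy, rfl⟩, hy'⟩ := hpq
  generalize hex.choose = p' at hp' hx'
  have hpp : p' + proj (y - x) = p := by
    rw [← hx', ← hy', proj_sub]; simp
  have hseg := hNK p' hp' (y - x) (hMN x hx y hy) (hpp ▸ hp)
  have hconn : IsPreconnected (Set.range fun s : ℝ => p' + proj (s • (y - x))) := by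
    refine isPreconnected_range ?_
    exact continuous_const.add (continuous_proj.comp (by fun_prop))
  refine connectedComponentIn_eq ?_
  refine hconn.subset_connectedComponentIn ⟨0, ?_⟩ ?_ ⟨1, ?_⟩
  · simp [proj, Pi.add_def]
  · rintro _ ⟨s, rfl⟩; exact hseg s
  · simpa using hpp

end ToricArr

namespace ToricArrangement

variable {n : ℕ} (𝓗 : ToricArrangement n)

lemma finite_flats : 𝓗.flats.Finite := by
  have h : (⋃ S ∈ {S | S ⊆ 𝓗.hyperplanes}, components (⋂₀ S)).Finite := by
    refine Set.Finite.biUnion 𝓗.finite_hyperplanes.finite_subsets fun S hS => ?_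
    refine finite_components (𝓗.finite_hyperplanes.subset hS) fun H hH => ?_
    obtain ⟨k, -, hk⟩ := 𝓗.isToricHyperplane H (hS hH)
    exact ⟨k, hk⟩
  refine (h.insert ∅).subset ?_
  rintro x (rfl | ⟨S, hS, hx⟩)
  · exact Set.mem_insert _ _
  · exact Set.mem_insert_of_mem _ (Set.mem_iUnion₂.2 ⟨S, hS, hx⟩)

lemma univ_mem_flats : Set.univ ∈ 𝓗.flats := by
  refine Or.inr ⟨∅, Set.empty_subset _, 0, by simp, ?_⟩
  rw [Set.sInter_empty, connectedComponentIn_univ, PreconnectedSpace.connectedComponent_eq_univ]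

lemma empty_mem_flats : ∅ ∈ 𝓗.flats := Or.inl rfl

instance : Finite 𝓗.flats := 𝓗.finite_flats.to_subtype

instance : Fintype 𝓗.IntersectionPoset := Fintype.ofFinite _

/-- The minimal element is the whole torus and the maximal element is the empty set. -/
instance : BoundedOrder 𝓗.IntersectionPoset where
  bot := OrderDual.toDual ⟨Set.univ, 𝓗.univ_mem_flats⟩
  bot_le x := Set.subset_univ (toSet x)
  top := OrderDual.toDual ⟨∅, 𝓗.empty_mem_flats⟩
  le_top x := Set.empty_subset (toSet x)

end ToricArrangement

/-! ### Möbius function, characteristic polynomial and Zaslavsky invariant -/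

open Classical in
/-- The Möbius function `μ(x, y)` of a finite poset, with integer values. -/
def posetMoebius {P : Type*} [PartialOrder P] [Fintype P] (x y : P) : ℤ :=
  letI : LocallyFiniteOrder P := Fintype.toLocallyFiniteOrder
  IncidenceAlgebra.mu ℤ x y

/-- The rank `ρ(0̂, x)` of an element of a finite graded poset: the length of a longest chain
ending at `x`. -/
def posetRank {P : Type*} [PartialOrder P] (x : P) : ℕ := (Order.height x).toNat

open Classical in
/-- The toric Zaslavsky invariant of a finite graded poset: the sum of
`(-1) ^ ρ(0̂, x) * μ(0̂, x)` over all coatoms `x`. -/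
def toricZaslavsky (P : Type*) [PartialOrder P] [BoundedOrder P] [Fintype P] : ℤ :=
  ∑ x : P with IsCoatom x, (-1) ^ posetRank x * posetMoebius ⊥ x

namespace ToricArrangement

open Classical in
/-- The toric characteristic polynomial: the sum of `μ(0̂, x) * t ^ dim x` over all nonempty
elements `x` of the intersection poset. -/
def charPoly {n : ℕ} (𝓗 : ToricArrangement n) : Polynomial ℤ :=
  ∑ x : 𝓗.IntersectionPoset with toSet x ≠ ∅,
    Polynomial.C (posetMoebius ⊥ x) * Polynomial.X ^ toricDim (toSet x)

end ToricArrangement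

end

/-!
Each hyperplane `H` has an equation `α v ∈ c + ℤ`, where the linear form `α` maps `ℤⁿ` onto `ℤ`.
Lifted to `ℝⁿ`, the hyperplanes form a periodic arrangement of affine hyperplanes, and a region is
the image of one of its open cells (`Equations.connectedComponentIn_complement`).

If the forms `α` had a common kernel, this kernel would contain a nonzero lattice vector, so that a
region would contain a closed curve with nonzero winding number in some coordinate. A region that is
an open ball contains no such curve, so the arrangement is essential (`Equations.isEssential`).
Hence the cells are bounded, the coatoms of the intersection poset are the points
(`Equations.isCoatom_iff`), and codimension grades the poset (`Equations.gradeMinOrder`).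

Fix a linear functional `ℓ` on `ℝⁿ` that is generic for the arrangement. It attains its minimum on
a closed cell at exactly one point, which is a vertex. So the regions correspond to the pairs of a
point `p` of the poset and a chamber of the central arrangement at `p` on whose closure `ℓ` is
positive away from the apex (`Equations.finite_regions_and_ncard`). Deletion and restriction show
that the number of these chambers is `(-1)ⁿ ∑ (-1) ^ |S|`, where `S` runs over the sets of
hyperplanes through `p` whose normal vectors span (`sum_isPositiveCone`). These `S` are the sets of
hyperplanes whose intersection has `{p}` as a component, and for any nonempty flat `x` the
corresponding alternating sum satisfies the recursion that defines `μ(⊥, x)`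
(`Equations.posetMoebius_eq_sum`). Therefore the number of regions is the sum of `(-1)ⁿ μ(⊥, p)`
over the points `p`, which are the coatoms, of rank `n`, and the flats of dimension `0`.
-/

noncomputable section

namespace ToricArr

open Topology

/-! ### Central arrangements: counting the chambers on which a generic functional is positive -/

section Central

variable {ι V : Type*} [AddCommGroup V] [Module ℝ V]

/-- The common zeros in `W` of the functionals `a i`, `i ∈ S`. -/
def commonKer (a : ι → V →ₗ[ℝ] ℝ) (W : Submodule ℝ V) (S : Finset ι) : Submodule ℝ V :=
  W ⊓ ⨅ i ∈ S, LinearMap.ker (a i)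

lemma mem_commonKer {a : ι → V →ₗ[ℝ] ℝ} {W : Submodule ℝ V} {S : Finset ι} {u : V} :
    u ∈ commonKer a W S ↔ u ∈ W ∧ ∀ i ∈ S, a i u = 0 := by
  simp [commonKer, Submodule.mem_iInf]

lemma commonKer_insert [DecidableEq ι] (a : ι → V →ₗ[ℝ] ℝ) (W : Submodule ℝ V) (i : ι)
    (S : Finset ι) :
    commonKer a W (insert i S) = commonKer a (W ⊓ LinearMap.ker (a i)) S := by
  ext u
  simp [mem_commonKer, and_assoc]

/-- The functional `ℓ` does not vanish identically on any nonzero intersection of `W` with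
kernels of the functionals `a i`, `i ∈ s`. -/
def IsGeneric (a : ι → V →ₗ[ℝ] ℝ) (ℓ : V →ₗ[ℝ] ℝ) (W : Submodule ℝ V) (s : Finset ι) : Prop :=
  ∀ S ⊆ s, commonKer a W S ≠ ⊥ → ∃ u ∈ commonKer a W S, ℓ u ≠ 0

/-- The open cone of `W` on which all `b j`, `j ∈ s`, are positive is nonempty, and `ℓ` is
positive on the corresponding closed cone away from the origin. -/
def IsPositiveCone (b : ι → V →ₗ[ℝ] ℝ) (ℓ : V →ₗ[ℝ] ℝ) (W : Submodule ℝ V) (s : Finset ι) :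
    Prop :=
  (∃ u ∈ W, ∀ j ∈ s, 0 < b j u) ∧ ∀ u ∈ W, (∀ j ∈ s, 0 ≤ b j u) → u ≠ 0 → 0 < ℓ u

open Classical in
/-- The family `a` with signs: `+` for the indices in `T`, and `-` for the others. -/
def signed (a : ι → V →ₗ[ℝ] ℝ) (T : Finset ι) (j : ι) : V →ₗ[ℝ] ℝ := if j ∈ T then a j else -a j

/-- The two conditions of `IsPositiveCone` for the half of the cone on the positive side of the
hyperplane `c = 0`. -/
def IsPositiveHalf (b : ι → V →ₗ[ℝ] ℝ) (ℓ : V →ₗ[ℝ] ℝ) (W : Submodule ℝ V) (s : Finset ι)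
    (c : V →ₗ[ℝ] ℝ) : Prop :=
  (∃ u ∈ W, 0 < c u ∧ ∀ j ∈ s, 0 < b j u) ∧
    ∀ u ∈ W, 0 ≤ c u → (∀ j ∈ s, 0 ≤ b j u) → u ≠ 0 → 0 < ℓ u

variable {b : ι → V →ₗ[ℝ] ℝ} {ℓ : V →ₗ[ℝ] ℝ} {W : Submodule ℝ V} {s : Finset ι} {c : V →ₗ[ℝ] ℝ}

/-- A point of an open cone can be moved a little in any direction. -/
lemma exists_pos_add_smul_mem {u : V} (hu : ∀ j ∈ s, 0 < b j u) (w : V) :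
    ∃ t : ℝ, 0 < t ∧ ∀ j ∈ s, 0 < b j (u + t • w) := by
  have h : ∀ᶠ t : ℝ in 𝓝[>] 0, ∀ j ∈ s, 0 < b j (u + t • w) := by
    refine (Filter.eventually_all_finset s).2 fun j hj => ?_
    have hc : Continuous fun t : ℝ => b j (u + t • w) := by
      simp only [map_add, map_smul, smul_eq_mul]; fun_prop
    have := hc.tendsto 0
    simp only [zero_smul, add_zero] at this
    exact (this.eventually (lt_mem_nhds (hu j hj))).filter_mono nhdsWithin_le_nhds
  obtain ⟨t, ht, ht'⟩ := (h.and self_mem_nhdsWithin).exists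
  exact ⟨t, ht', ht⟩

/-- If the hyperplane `c = 0` meets the open cone, both sides of it do. -/
lemma exists_mem_cone_pos {u w : V} (hu : u ∈ W) (hub : ∀ j ∈ s, 0 < b j u) (huc : c u = 0)
    (hw : w ∈ W) (hwc : c w ≠ 0) : ∃ u ∈ W, 0 < c u ∧ ∀ j ∈ s, 0 < b j u := by
  obtain ⟨t, ht, h⟩ := exists_pos_add_smul_mem hub (c w • w)
  refine ⟨_, W.add_mem hu (W.smul_mem t (W.smul_mem _ hw)), ?_, h⟩
  have : 0 < t * (c w * c w) := mul_pos ht (mul_self_pos.2 hwc)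
  simpa [huc] using this

/-- A segment joining the two sides of the hyperplane `c = 0` inside a cone crosses it. -/
lemma exists_mem_cone_zero {u v : V} (hu : u ∈ W) (hv : v ∈ W) (huc : 0 < c u) (hvc : c v < 0)
    (hub : ∀ j ∈ s, 0 < b j u) (hvb : ∀ j ∈ s, 0 ≤ b j v) :
    ∃ u ∈ W ⊓ LinearMap.ker c, ∀ j ∈ s, 0 < b j u := by
  refine ⟨(-c v) • u + c u • v, ⟨W.add_mem (W.smul_mem _ hu) (W.smul_mem _ hv), ?_⟩, ?_⟩
  · simp only [SetLike.mem_coe, LinearMap.mem_ker, map_add, map_smul, smul_eq_mul]; ring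
  · intro j hj
    simp only [map_add, map_smul, smul_eq_mul]
    exact add_pos_of_pos_of_nonneg (mul_pos (neg_pos.2 hvc) (hub j hj))
      (mul_nonneg huc.le (hvb j hj))

lemma IsPositiveHalf.cone_or_section (h : IsPositiveHalf b ℓ W s c) :
    IsPositiveCone b ℓ W s ∨ IsPositiveCone b ℓ (W ⊓ LinearMap.ker c) s := by
  obtain ⟨⟨u, hu, huc, hub⟩, hD⟩ := h
  by_cases hH : ∃ u ∈ W ⊓ LinearMap.ker c, ∀ j ∈ s, 0 < b j u
  · exact Or.inr ⟨hH, fun v hv hvb hv0 => hD v hv.1 (le_of_eq (Eq.symm hv.2)) hvb hv0⟩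
  · refine Or.inl ⟨⟨u, hu, hub⟩, fun v hv hvb hv0 => hD v hv ?_ hvb hv0⟩
    by_contra! hc
    exact hH (exists_mem_cone_zero hu hv huc hc hub hvb)

lemma IsPositiveHalf.cone_and_section (h : IsPositiveHalf b ℓ W s c)
    (h' : IsPositiveHalf b ℓ W s (-c)) :
    IsPositiveCone b ℓ W s ∧ IsPositiveCone b ℓ (W ⊓ LinearMap.ker c) s := by
  obtain ⟨⟨u, hu, huc, hub⟩, hD⟩ := h
  obtain ⟨⟨v, hv, hvc, hvb⟩, hD'⟩ := h'
  have hvc' : c v < 0 := by simpa using hvc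
  refine ⟨⟨⟨u, hu, hub⟩, fun w hw hwb hw0 => ?_⟩,
    ⟨exists_mem_cone_zero hu hv huc hvc' hub (fun j hj => (hvb j hj).le),
      fun w hw hwb hw0 => hD w hw.1 (le_of_eq (Eq.symm hw.2)) hwb hw0⟩⟩
  rcases le_total 0 (c w) with h | h
  · exact hD w hw h hwb hw0
  · exact hD' w hw (by simpa using h) hwb hw0

lemma IsPositiveCone.half (h : IsPositiveCone b ℓ W s)
    (h' : IsPositiveCone b ℓ (W ⊓ LinearMap.ker c) s) (hc : ∃ w ∈ W, c w ≠ 0) :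
    IsPositiveHalf b ℓ W s c := by
  obtain ⟨⟨u, hu, hub⟩, -⟩ := h'
  obtain ⟨w, hw, hwc⟩ := hc
  exact ⟨exists_mem_cone_pos hu.1 hub hu.2 hw hwc, fun v hv _ => h.2 v hv⟩

/-- If `ℓ` is positive on the closed cone, then it is positive on the half of it on a side of
`c = 0` that contains a point of the open cone. -/
lemma IsPositiveCone.half_or_half (h : IsPositiveCone b ℓ W s) (hc : ∃ w ∈ W, c w ≠ 0) :
    IsPositiveHalf b ℓ W s c ∨ IsPositiveHalf b ℓ W s (-c) := by
  obtain ⟨⟨u, hu, hub⟩, hD⟩ := h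
  obtain ⟨w, hw, hwc⟩ := hc
  rcases lt_trichotomy (c u) 0 with h | h | h
  · exact Or.inr ⟨⟨u, hu, by simpa using h, hub⟩, fun v hv _ => hD v hv⟩
  · exact Or.inl ⟨exists_mem_cone_pos hu hub h hw hwc, fun v hv _ => hD v hv⟩
  · exact Or.inl ⟨⟨u, hu, h, hub⟩, fun v hv _ => hD v hv⟩

/-- If `ℓ` is positive on the section of the closed cone by `c = 0`, then it is positive on one
of the two halves: points `u`, `v` of the closed cone on the two sides at which `ℓ ≤ 0` combine
to a point of the section with `ℓ ≤ 0`. This point is `0` only if `u` spans a line in the closed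
cone, and then genericity of `ℓ` gives a contradiction. -/
lemma IsPositiveCone.half_or_half_of_section (h₀ : IsPositiveCone b ℓ (W ⊓ LinearMap.ker c) s)
    (hc : ∃ w ∈ W, c w ≠ 0)
    (hℓ : commonKer b W s ≠ ⊥ → ∃ u ∈ commonKer b W s, ℓ u ≠ 0) :
    IsPositiveHalf b ℓ W s c ∨ IsPositiveHalf b ℓ W s (-c) := by
  obtain ⟨⟨u₀, hu₀, hub₀⟩, hD⟩ := h₀
  obtain ⟨w, hw, hwc⟩ := hc
  have hpos := exists_mem_cone_pos hu₀.1 hub₀ hu₀.2 hw hwc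
  have hneg := exists_mem_cone_pos (c := -c) hu₀.1 hub₀
    (by simpa using hu₀.2) hw (by simpa using hwc)
  by_contra! hcon
  simp only [IsPositiveHalf, hpos, hneg, true_and, not_forall, exists_prop, not_lt] at hcon
  obtain ⟨⟨u, hu, huc, hub, hu0, huℓ⟩, ⟨v, hv, hvc, hvb, hv0, hvℓ⟩⟩ := hcon
  have huc' : 0 < c u := huc.lt_of_ne fun h => (hD u ⟨hu, h.symm⟩ hub hu0).not_ge huℓ
  have hvc' : c v < 0 := by
    refine lt_of_le_of_ne (by simpa using hvc) fun h => (hD v ⟨hv, h⟩ hvb hv0).not_ge hvℓ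
  have hx0 : (-c v) • u + c u • v = 0 := by
    by_contra hne
    refine (hD ((-c v) • u + c u • v) ⟨W.add_mem (W.smul_mem _ hu) (W.smul_mem _ hv), ?_⟩
      (fun j hj => ?_) hne).not_ge ?_
    · simp only [SetLike.mem_coe, LinearMap.mem_ker, map_add, map_smul, smul_eq_mul]; ring
    · simp only [map_add, map_smul, smul_eq_mul]
      exact add_nonneg (mul_nonneg (neg_pos.2 hvc').le (hub j hj))
        (mul_nonneg huc'.le (hvb j hj))
    · simp only [map_add, map_smul, smul_eq_mul]
      exact add_nonpos (mul_nonpos_of_nonneg_of_nonpos (neg_pos.2 hvc').le huℓ)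
        (mul_nonpos_of_nonneg_of_nonpos huc'.le hvℓ)
  have hline : u ∈ commonKer b W s := by
    refine mem_commonKer.2 ⟨hu, fun j hj => ?_⟩
    have h1 := congrArg (b j) hx0
    simp only [map_add, map_smul, smul_eq_mul, map_zero] at h1
    have h2 := mul_nonneg huc'.le (hvb j hj)
    have h3 := mul_nonneg (neg_pos.2 hvc').le (hub j hj)
    exact (mul_eq_zero.1 (le_antisymm (by linarith) h3)).resolve_left (neg_pos.2 hvc').ne'
  obtain ⟨x, hx, hxℓ⟩ := hℓ fun h => hu0 (by rw [h] at hline; simpa using hline)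
  have hℓu : ℓ u = 0 := by
    have h1 := congrArg ℓ hx0
    simp only [map_add, map_smul, smul_eq_mul, map_zero] at h1
    have h2 := mul_nonpos_of_nonneg_of_nonpos huc'.le hvℓ
    have h3 := mul_nonpos_of_nonneg_of_nonpos (neg_pos.2 hvc').le huℓ
    exact (mul_eq_zero.1 (le_antisymm h3 (by linarith))).resolve_left (neg_pos.2 hvc').ne'
  obtain ⟨hxW, hxb⟩ := mem_commonKer.1 hx
  obtain ⟨-, hub'⟩ := mem_commonKer.1 hline
  -- The closed section contains the line through `c u • x - c x • u`, on which `ℓ` does not vanish.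
  have key : ∀ r : ℝ, r ≠ 0 → 0 < r * (ℓ x * c u) := by
    intro r hr
    have hℓr : ℓ (r • (c u • x - c x • u)) = r * (ℓ x * c u) := by
      simp only [map_sub, map_smul, smul_eq_mul, hℓu]; ring
    rw [← hℓr]
    refine hD _ ⟨W.smul_mem _ (W.sub_mem (W.smul_mem _ hxW) (W.smul_mem _ hu)), ?_⟩ ?_ ?_
    · simp only [SetLike.mem_coe, LinearMap.mem_ker, map_sub, map_smul, smul_eq_mul]; ring
    · intro j hj
      simp [hxb j hj, hub' j hj]
    · intro h0
      rw [h0, map_zero] at hℓr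
      exact mul_ne_zero hr (mul_ne_zero hxℓ huc'.ne') hℓr.symm
  have h1 := key 1 one_ne_zero
  have h2 := key (-1) (by norm_num)
  linarith

open Classical in
/-- The two cones into which the hyperplane `c = 0` cuts a cone are, as far as the number of
positive ones goes, the uncut cone and its section by `c = 0`. -/
lemma card_positive_halves (hc : ∃ w ∈ W, c w ≠ 0)
    (hℓ : commonKer b W s ≠ ⊥ → ∃ u ∈ commonKer b W s, ℓ u ≠ 0) :
    ((if IsPositiveHalf b ℓ W s c then 1 else 0) +
        if IsPositiveHalf b ℓ W s (-c) then 1 else 0 : ℤ) =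
      (if IsPositiveCone b ℓ W s then 1 else 0) +
        if IsPositiveCone b ℓ (W ⊓ LinearMap.ker c) s then 1 else 0 := by
  have hker : LinearMap.ker (-c) = LinearMap.ker c := by ext; simp
  have hc' : ∃ w ∈ W, (-c) w ≠ 0 := by simpa using hc
  by_cases h1 : IsPositiveCone b ℓ W s <;>
    by_cases h2 : IsPositiveCone b ℓ (W ⊓ LinearMap.ker c) s
  · have h3 := h1.half h2 hc
    have h4 := h1.half (c := -c) (by rwa [hker]) hc'
    simp [h1, h2, h3, h4]
  · have h3 := h1.half_or_half hc
    have h4 : ¬ (IsPositiveHalf b ℓ W s c ∧ IsPositiveHalf b ℓ W s (-c)) :=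
      fun h => h2 (h.1.cone_and_section h.2).2
    by_cases h5 : IsPositiveHalf b ℓ W s c <;> by_cases h6 : IsPositiveHalf b ℓ W s (-c) <;>
      simp_all
  · have h3 := h2.half_or_half_of_section hc hℓ
    have h4 : ¬ (IsPositiveHalf b ℓ W s c ∧ IsPositiveHalf b ℓ W s (-c)) :=
      fun h => h1 (h.1.cone_and_section h.2).1
    by_cases h5 : IsPositiveHalf b ℓ W s c <;> by_cases h6 : IsPositiveHalf b ℓ W s (-c) <;>
      simp_all
  · have h3 : ¬ IsPositiveHalf b ℓ W s c := fun h => h.cone_or_section.elim h1 h2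
    have h4 : ¬ IsPositiveHalf b ℓ W s (-c) := fun h => by
      have := h.cone_or_section
      rw [hker] at this
      exact this.elim h1 h2
    simp [h1, h2, h3, h4]

lemma isPositiveCone_signed_insert [DecidableEq ι] {a : ι → V →ₗ[ℝ] ℝ} {i : ι} (hi : i ∉ s)
    {T : Finset ι} (hT : T ⊆ s) :
    (IsPositiveCone (signed a (insert i T)) ℓ W (insert i s) ↔
        IsPositiveHalf (signed a T) ℓ W s (a i)) ∧
      (IsPositiveCone (signed a T) ℓ W (insert i s) ↔
        IsPositiveHalf (signed a T) ℓ W s (-a i)) := by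
  have hiT : i ∉ T := fun h => hi (hT h)
  have h1 : ∀ j ∈ s, signed a (insert i T) j = signed a T j := by
    intro j hj
    have : j ≠ i := fun h => hi (h ▸ hj)
    simp [signed, this]
  have h2 : ∀ u, (∀ j ∈ s, 0 < signed a (insert i T) j u) ↔ ∀ j ∈ s, 0 < signed a T j u :=
    fun u => forall₂_congr fun j hj => by rw [h1 j hj]
  have h3 : ∀ u, (∀ j ∈ s, 0 ≤ signed a (insert i T) j u) ↔ ∀ j ∈ s, 0 ≤ signed a T j u :=
    fun u => forall₂_congr fun j hj => by rw [h1 j hj]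
  have h4 : signed a (insert i T) i = a i := by simp [signed]
  have h5 : signed a T i = -a i := by simp [signed, hiT]
  constructor
  · simp only [IsPositiveCone, IsPositiveHalf, Finset.forall_mem_insert, h2, h3, h4, and_imp]
  · simp only [IsPositiveCone, IsPositiveHalf, Finset.forall_mem_insert, h5, and_imp]

lemma finrank_inf_ker [FiniteDimensional ℝ V] (hc : ∃ w ∈ W, c w ≠ 0) :
    Module.finrank ℝ W = Module.finrank ℝ ↥(W ⊓ LinearMap.ker c) + 1 := by
  obtain ⟨w, hw, hwc⟩ := hc
  have hr := LinearMap.finrank_range_add_finrank_ker (c.domRestrict W)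
  have h1 : LinearMap.range (c.domRestrict W) = ⊤ :=
    LinearMap.range_eq_top.2 (LinearMap.surjective_of_ne_zero fun h =>
      hwc (by simpa using LinearMap.congr_fun h ⟨w, hw⟩))
  have h2 : (LinearMap.ker (c.domRestrict W)).map W.subtype = W ⊓ LinearMap.ker c := by
    ext u; simp [and_comm]
  rw [← h2, LinearEquiv.finrank_eq (Submodule.equivMapOfInjective W.subtype
    W.injective_subtype _).symm, ← hr, h1, finrank_top, Module.finrank_self]
  ring

open Classical in
/-- **Count of positive chambers.** In a central arrangement in `W`, the number of chambers on
whose closure a generic functional is positive away from the origin is, up to the sign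
`(-1) ^ dim W`, the alternating number of subarrangements with intersection `{0}`. The proof is by
deletion and restriction. -/
theorem sum_isPositiveCone [FiniteDimensional ℝ V] (a : ι → V →ₗ[ℝ] ℝ) (ℓ : V →ₗ[ℝ] ℝ)
    (s : Finset ι) (W : Submodule ℝ V) (hℓ : IsGeneric a ℓ W s) :
    (∑ T ∈ s.powerset, if IsPositiveCone (signed a T) ℓ W s then 1 else 0 : ℤ) =
      (-1) ^ Module.finrank ℝ W *
        ∑ S ∈ s.powerset, if commonKer a W S = ⊥ then (-1) ^ S.card else 0 := by
  induction s using Finset.induction_on generalizing W with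
  | empty =>
    have h1 : commonKer a W ∅ = W := by simp [commonKer]
    simp only [Finset.powerset_empty, Finset.sum_singleton, h1, Finset.card_empty, pow_zero]
    by_cases hW : W = ⊥
    · subst hW
      simp [IsPositiveCone]
    · have : ¬ IsPositiveCone (signed a ∅) ℓ W ∅ := by
        rintro ⟨-, h⟩
        obtain ⟨u, hu, hu0⟩ := W.exists_mem_ne_zero_of_ne_bot hW
        have h2 := h u hu (by simp) hu0
        have h3 := h (-u) (W.neg_mem hu) (by simp) (neg_ne_zero.2 hu0)
        rw [map_neg] at h3
        linarith
      simp [hW, this]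
  | insert i s hi ih =>
    have hgen : IsGeneric a ℓ W s := fun S hS => hℓ S (hS.trans (Finset.subset_insert i s))
    rw [Finset.sum_powerset_insert hi, Finset.sum_powerset_insert hi]
    by_cases hc : ∃ w ∈ W, a i w ≠ 0
    · have hgen' : IsGeneric a ℓ (W ⊓ LinearMap.ker (a i)) s := by
        intro S hS
        rw [← commonKer_insert]
        exact hℓ _ (Finset.insert_subset_insert i hS)
      have hdim := finrank_inf_ker hc
      have ih1 := ih W hgen
      have ih2 := ih _ hgen'
      have key : ∀ T ∈ s.powerset,
          ((if IsPositiveCone (signed a T) ℓ W (insert i s) then 1 else 0) +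
            if IsPositiveCone (signed a (insert i T)) ℓ W (insert i s) then 1 else 0 : ℤ) =
          (if IsPositiveCone (signed a T) ℓ W s then 1 else 0) +
            if IsPositiveCone (signed a T) ℓ (W ⊓ LinearMap.ker (a i)) s then 1 else 0 := by
        intro T hT
        obtain ⟨h1, h2⟩ := isPositiveCone_signed_insert (ℓ := ℓ) (W := W) (a := a) hi
          (Finset.mem_powerset.1 hT)
        have h3 : commonKer (signed a T) W s = commonKer a W s := by
          ext u
          simp only [mem_commonKer]
          refine and_congr_right fun _ => forall₂_congr fun j _ => ?_
          unfold signed; split_ifs <;> simp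
        rw [← card_positive_halves hc (by rw [h3]; exact hgen s subset_rfl), add_comm]
        simp only [h1, h2]
      rw [← Finset.sum_add_distrib, Finset.sum_congr rfl key, Finset.sum_add_distrib, ih1, ih2,
        hdim, mul_add]
      congr 1
      rw [pow_succ, mul_neg_one, neg_mul, ← mul_neg, ← Finset.sum_neg_distrib]
      congr 1
      refine Finset.sum_congr rfl fun S hS => ?_
      rw [commonKer_insert, Finset.card_insert_of_notMem fun h => hi (Finset.mem_powerset.1 hS h)]
      split_ifs <;> simp [pow_succ]
    · -- If `a i` vanishes on `W`, there are no chambers, and `S` and `insert i S` cancel.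
      push Not at hc
      have h1 : W ⊓ LinearMap.ker (a i) = W := inf_eq_left.2 fun w hw => hc w hw
      have h2 : ∀ T, ¬ IsPositiveCone (signed a T) ℓ W (insert i s) := by
        rintro T ⟨⟨u, hu, hub⟩, -⟩
        have := hub i (Finset.mem_insert_self i s)
        unfold signed at this
        split_ifs at this <;> simp [hc u hu] at this
      simp only [h2, if_false, Finset.sum_const_zero, add_zero]
      rw [← Finset.sum_add_distrib, Finset.sum_eq_zero, mul_zero]
      intro S hS
      rw [commonKer_insert, h1,
        Finset.card_insert_of_notMem fun h => hi (Finset.mem_powerset.1 hS h)]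
      split_ifs <;> simp [pow_succ]

end Central

end ToricArr

/-! ### Equations of toric hyperplanes -/

namespace ToricArr

open Topology

/-- The vector of `ℝⁿ` with the given integer entries. -/
def latticeVec {n : ℕ} (z : Fin n → ℤ) : Fin n → ℝ := fun j => z j

lemma latticeVec_smul {n : ℕ} (m : ℤ) (z : Fin n → ℤ) :
    latticeVec (m • z) = (m : ℝ) • latticeVec z := by
  ext; simp [latticeVec]

lemma proj_eq_proj_iff {n : ℕ} {v w : Fin n → ℝ} :
    proj v = proj w ↔ ∃ z : Fin n → ℤ, v = w + latticeVec z := by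
  constructor
  · intro h
    have h1 : ∀ j, ∃ z : ℤ, (z : ℝ) = v j - w j := fun j => by
      have h2 : ((v j - w j : ℝ) : UnitAddCircle) = 0 := by
        rw [AddCircle.coe_sub, sub_eq_zero]
        exact congrFun h j
      obtain ⟨z, hz⟩ := (AddCircle.coe_eq_zero_iff (1 : ℝ)).1 h2
      exact ⟨z, by simpa using hz⟩
    choose z hz using h1
    exact ⟨z, by ext j; simp [latticeVec, hz]⟩
  · rintro ⟨z, rfl⟩
    ext j
    simp [proj, latticeVec]

lemma proj_add_latticeVec {n : ℕ} (v : Fin n → ℝ) (z : Fin n → ℤ) :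
    proj (v + latticeVec z) = proj v :=
  proj_eq_proj_iff.2 ⟨z, rfl⟩

lemma proj_surjective {n : ℕ} : Function.Surjective (proj (n := n)) := fun q => by
  choose v hv using fun j => QuotientAddGroup.mk_surjective (q j)
  exact ⟨v, funext hv⟩

/-- A nonzero row of a rational matrix has a multiple that maps the lattice `ℤⁿ` onto `ℤ`. -/
lemma exists_form_of_row {n m : ℕ} (A : Matrix (Fin m) (Fin n) ℚ) (i : Fin m) (hi : A i ≠ 0) :
    ∃ α : (Fin n → ℝ) →ₗ[ℝ] ℝ, (∀ z : Fin n → ℤ, ∃ k : ℤ, α (latticeVec z) = k) ∧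
      (∃ z : Fin n → ℤ, α (latticeVec z) = 1) ∧
      ∀ v, (A.map (fun q : ℚ => (q : ℝ))).mulVec v = 0 → α v = 0 := by
  obtain ⟨j₀, hj₀⟩ := Function.ne_iff.1 hi
  let D : ℤ := ∏ j, ((A i j).den : ℤ)
  have hD : (D : ℚ) ≠ 0 := by
    simp [D, Finset.prod_ne_zero_iff]
  have hint : ∀ j, ∃ k : ℤ, (D : ℚ) * A i j = k := fun j => by
    obtain ⟨k, hk⟩ : ((A i j).den : ℤ) ∣ D := Finset.dvd_prod_of_mem _ (Finset.mem_univ j)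
    refine ⟨k * (A i j).num, ?_⟩
    have h1 : ((A i j).den : ℚ) * A i j = (A i j).num := Rat.den_mul_eq_num _
    rw [hk]
    push_cast
    rw [← h1]; ring
  choose c hc using hint
  let f : (Fin n → ℤ) →ₗ[ℤ] ℤ := ∑ j, c j • LinearMap.proj j
  have hf : ∀ z, f z = ∑ j, c j * z j := fun z => by simp [f]
  -- The values of the integral functional `f` on `ℤⁿ` are the multiples of `g`.
  let g : ℤ := Submodule.IsPrincipal.generator (LinearMap.range f)
  have hg : ∀ z, ∃ k : ℤ, f z = k * g := fun z => by
    obtain ⟨k, hk⟩ := (Submodule.IsPrincipal.mem_iff_eq_smul_generator _).1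
      (LinearMap.mem_range_self f z)
    exact ⟨k, by simpa using hk⟩
  obtain ⟨z₁, hz₁⟩ : ∃ z, f z = g :=
    LinearMap.mem_range.1 (Submodule.IsPrincipal.generator_mem (LinearMap.range f))
  have hg0 : (g : ℝ) ≠ 0 := by
    intro h0
    have h0' : g = 0 := by exact_mod_cast h0
    obtain ⟨k, hk⟩ := hg (Pi.single j₀ 1)
    rw [h0', mul_zero, hf] at hk
    have hcj : c j₀ = 0 := by simpa [Pi.single_apply] using hk
    have := hc j₀
    rw [hcj, Int.cast_zero] at this
    exact (mul_ne_zero hD hj₀) this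
  let α : (Fin n → ℝ) →ₗ[ℝ] ℝ := (g : ℝ)⁻¹ • ∑ j, (c j : ℝ) • LinearMap.proj j
  have hα : ∀ v, α v = (g : ℝ)⁻¹ * ∑ j, c j * v j := fun v => by simp [α]
  have hαf : ∀ z, α (latticeVec z) = (g : ℝ)⁻¹ * f z := fun z => by
    rw [hα, hf]; push_cast; rfl
  refine ⟨α, fun z => ?_, ⟨z₁, ?_⟩, fun v hv => ?_⟩
  · obtain ⟨k, hk⟩ := hg z
    refine ⟨k, ?_⟩
    rw [hαf, hk]; push_cast; field_simp
  · rw [hαf, hz₁]; field_simp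
  · rw [hα]
    have h1 : ∑ j, (c j : ℝ) * v j = D * ∑ j, (A i j : ℝ) * v j := by
      rw [Finset.mul_sum]
      refine Finset.sum_congr rfl fun j _ => ?_
      have : (D : ℝ) * (A i j : ℝ) = c j := by exact_mod_cast hc j
      rw [← this]; ring
    have h2 : ∑ j, (A i j : ℝ) * v j = 0 := by
      simpa [Matrix.mulVec, dotProduct] using congrFun hv i
    rw [h1, h2]; simp

/-- A toric hyperplane has an equation `α v ∈ c + ℤ`, where `α` maps `ℤⁿ` onto `ℤ`. -/
lemma IsToricHyperplane.exists_equation {n : ℕ} {H : Set (Torus n)} (hH : IsToricHyperplane H) :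
    ∃ (α : (Fin n → ℝ) →ₗ[ℝ] ℝ) (c : ℝ), (∀ z : Fin n → ℤ, ∃ k : ℤ, α (latticeVec z) = k) ∧
      (∃ z : Fin n → ℤ, α (latticeVec z) = 1) ∧
      ∀ v, proj v ∈ H ↔ ∃ k : ℤ, α v = c + k := by
  obtain ⟨k, hk, V, ⟨v₀, hv₀⟩, ⟨m, A, b, hV⟩, hdim, rfl⟩ := hH
  set A' := A.map (fun q : ℚ => (q : ℝ)) with hA'
  have hdir : ∀ u, u ∈ V.direction ↔ A'.mulVec u = 0 := fun u => by
    rw [← V.vadd_mem_iff_mem_direction u hv₀, hV, vadd_eq_add, Matrix.mulVec_add,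
      (hV v₀).1 hv₀, add_eq_right]
  obtain ⟨i, hi⟩ : ∃ i, A i ≠ 0 := by
    by_contra! h
    have : V.direction = ⊤ := by
      refine eq_top_iff.2 fun u _ => (hdir u).2 ?_
      have h0 : A' = 0 := by ext i j; simp [hA', h i]
      rw [h0, Matrix.zero_mulVec]
    rw [this, finrank_top, Module.finrank_fin_fun] at hdim
    omega
  obtain ⟨α, hα, ⟨z₁, hz₁⟩, hker⟩ := exists_form_of_row A i hi
  have hle : V.direction ≤ LinearMap.ker α := fun u hu => hker u ((hdir u).1 hu)
  have heq : V.direction = LinearMap.ker α := by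
    refine Submodule.eq_of_le_of_finrank_eq hle ?_
    have hr := LinearMap.finrank_range_add_finrank_ker α
    have h1 : LinearMap.range α = ⊤ :=
      LinearMap.range_eq_top.2 (LinearMap.surjective_of_ne_zero fun h => by simp [h] at hz₁)
    rw [h1, finrank_top, Module.finrank_self, Module.finrank_fin_fun] at hr
    omega
  refine ⟨α, α v₀, hα, ⟨z₁, hz₁⟩, fun v => ⟨?_, ?_⟩⟩
  · rintro ⟨w, hw, hwv⟩
    obtain ⟨z, rfl⟩ := proj_eq_proj_iff.1 hwv.symm
    obtain ⟨l, hl⟩ := hα z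
    have h1 : α (w - v₀) = 0 := hle (V.vsub_mem_direction hw hv₀)
    rw [map_sub, sub_eq_zero] at h1
    exact ⟨l, by rw [map_add, hl, h1]⟩
  · rintro ⟨l, hl⟩
    refine ⟨v + latticeVec ((-l) • z₁), ?_, proj_add_latticeVec _ _⟩
    have h1 : v + latticeVec ((-l) • z₁) - v₀ ∈ V.direction := by
      rw [heq, LinearMap.mem_ker, map_sub, map_add, latticeVec_smul, map_smul, hz₁, hl]
      simp
    have := (V.vadd_mem_iff_mem_direction _ hv₀).2 h1
    simpa using this

/-- Points near `proj v` are of the form `proj (v + u)` with small `u`. -/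
lemma eventually_nhds_proj {n : ℕ} {v : Fin n → ℝ} {P : (Fin n → ℝ) → Prop}
    (h : ∀ᶠ u in 𝓝 0, P u) : ∀ᶠ q in 𝓝 (proj v), ∃ u, P u ∧ q = proj (v + u) := by
  have h1 : (fun u => v + u) '' {u | P u} ∈ 𝓝 v := by
    have := (Homeomorph.addLeft v).isOpenMap.image_mem_nhds h
    simpa using this
  filter_upwards [isOpenMap_proj.image_mem_nhds h1]
  rintro _ ⟨_, ⟨u, hu, rfl⟩, rfl⟩
  exact ⟨u, hu, rfl⟩

end ToricArr

namespace ToricArrangement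

open Topology ToricArr

/-- Equations `form H v ∈ const H + ℤ` of the hyperplanes of an arrangement, where each `form H`
maps the lattice `ℤⁿ` onto `ℤ`. -/
structure Equations {n : ℕ} (𝓗 : ToricArrangement n) where
  form : 𝓗.hyperplanes → (Fin n → ℝ) →ₗ[ℝ] ℝ
  const : 𝓗.hyperplanes → ℝ
  form_latticeVec : ∀ i (z : Fin n → ℤ), ∃ k : ℤ, form i (latticeVec z) = k
  exists_form_eq_one : ∀ i, ∃ z : Fin n → ℤ, form i (latticeVec z) = 1
  proj_mem_iff : ∀ i v, proj v ∈ i.1 ↔ ∃ k : ℤ, form i v = const i + k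

variable {n : ℕ} {𝓗 : ToricArrangement n}

lemma nonempty_equations (𝓗 : ToricArrangement n) : Nonempty 𝓗.Equations := by
  choose α c h1 h2 h3 using fun i : 𝓗.hyperplanes =>
    (𝓗.isToricHyperplane i.1 i.2).exists_equation
  exact ⟨⟨α, c, h1, h2, h3⟩⟩

instance : Finite 𝓗.hyperplanes := 𝓗.finite_hyperplanes.to_subtype

instance : Fintype 𝓗.hyperplanes := Fintype.ofFinite _

/-- The intersection of the hyperplanes in `S`. -/
def inter (S : Finset 𝓗.hyperplanes) : Set (Torus n) := {q | ∀ i ∈ S, q ∈ i.1}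

open Classical in
/-- The hyperplanes that contain `x`. -/
def through (𝓗 : ToricArrangement n) (x : Set (Torus n)) : Finset 𝓗.hyperplanes :=
  Finset.univ.filter fun i => x ⊆ i.1

lemma mem_through {x : Set (Torus n)} {i : 𝓗.hyperplanes} : i ∈ 𝓗.through x ↔ x ⊆ i.1 := by
  simp [through]

lemma mem_through_singleton {p : Torus n} {i : 𝓗.hyperplanes} :
    i ∈ 𝓗.through {p} ↔ p ∈ i.1 := by
  simp [mem_through]

lemma subset_inter_iff {x : Set (Torus n)} {S : Finset 𝓗.hyperplanes} :
    x ⊆ inter S ↔ S ⊆ 𝓗.through x := by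
  constructor
  · intro h i hi
    exact mem_through.2 fun q hq => h hq i hi
  · intro h q hq i hi
    exact mem_through.1 (h hi) hq

lemma mem_flats_iff {x : Set (Torus n)} :
    x ∈ 𝓗.flats ↔ x = ∅ ∨ ∃ S : Finset 𝓗.hyperplanes, x ∈ components (inter S) := by
  classical
  refine or_congr_right ⟨?_, ?_⟩
  · rintro ⟨S, hS, hx⟩
    refine ⟨Finset.univ.filter fun i => i.1 ∈ S, ?_⟩
    convert hx using 2
    ext q
    simp only [inter, Finset.mem_filter, Finset.mem_univ, true_and, Set.mem_ofPred_eq,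
      Set.mem_sInter, Subtype.forall]
    exact ⟨fun h H hH => h H (hS hH) hH, fun h H _ hH => h H hH⟩
  · rintro ⟨S, hx⟩
    refine ⟨Subtype.val '' (S : Set 𝓗.hyperplanes), by rintro _ ⟨i, -, rfl⟩; exact i.2, ?_⟩
    convert hx using 2
    ext q
    simp [inter]

namespace Equations

variable (E : 𝓗.Equations)

/-- The linear subspace parallel to the intersection of the hyperplanes in `S`. -/
def dir (S : Finset 𝓗.hyperplanes) : Submodule ℝ (Fin n → ℝ) := commonKer E.form ⊤ S

lemma mem_dir {S : Finset 𝓗.hyperplanes} {u : Fin n → ℝ} :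
    u ∈ E.dir S ↔ ∀ i ∈ S, E.form i u = 0 := by
  simp [dir, mem_commonKer]

lemma dir_anti {S T : Finset 𝓗.hyperplanes} (h : S ⊆ T) : E.dir T ≤ E.dir S := fun _ hu =>
  E.mem_dir.2 fun i hi => E.mem_dir.1 hu i (h hi)

lemma continuous_form (i : 𝓗.hyperplanes) : Continuous (E.form i) :=
  LinearMap.continuous_of_finiteDimensional _

lemma form_ne_zero (i : 𝓗.hyperplanes) : E.form i ≠ 0 := fun h => by
  obtain ⟨z, hz⟩ := E.exists_form_eq_one i
  simp [h] at hz

/-- Close to the origin, integral values of the forms vanish. -/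
lemma eventually_form_eq_zero :
    ∀ᶠ u : Fin n → ℝ in 𝓝 0, ∀ i, (∃ k : ℤ, E.form i u = k) → E.form i u = 0 := by
  refine Filter.eventually_all.2 fun i => ?_
  have h1 : ∀ᶠ u : Fin n → ℝ in 𝓝 0, |E.form i u| < 1 := by
    have := (E.continuous_form i).abs.tendsto 0
    rw [map_zero, abs_zero] at this
    exact this.eventually (gt_mem_nhds one_pos)
  filter_upwards [h1] with u hu
  rintro ⟨k, hk⟩
  rw [hk] at hu ⊢
  have : k = 0 := Int.abs_lt_one_iff.1 (by exact_mod_cast hu)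
  simp [this]

lemma exists_form_eq_int {v w : Fin n → ℝ} {i : 𝓗.hyperplanes} (hv : proj v ∈ i.1)
    (hw : proj (v + w) ∈ i.1) : ∃ k : ℤ, E.form i w = k := by
  obtain ⟨k, hk⟩ := (E.proj_mem_iff i v).1 hv
  obtain ⟨l, hl⟩ := (E.proj_mem_iff i _).1 hw
  rw [map_add, hk] at hl
  exact ⟨l - k, by push_cast; linarith⟩

lemma proj_add_mem {v w : Fin n → ℝ} {i : 𝓗.hyperplanes} (hv : proj v ∈ i.1)
    (hw : E.form i w = 0) : proj (v + w) ∈ i.1 := by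
  obtain ⟨k, hk⟩ := (E.proj_mem_iff i v).1 hv
  exact (E.proj_mem_iff i _).2 ⟨k, by rw [map_add, hw, hk, add_zero]⟩

/-- The connected components of an intersection of hyperplanes are the translates of the image of
its linear direction: these translates are connected, and open in the intersection. -/
lemma connectedComponentIn_inter {S : Finset 𝓗.hyperplanes} {v : Fin n → ℝ}
    (hv : proj v ∈ inter S) :
    connectedComponentIn (inter S) (proj v) = (fun u => proj (v + u)) '' (E.dir S) := by
  apply Set.Subset.antisymm
  · intro q hq
    have hsub := connectedComponentIn_subset (inter S) (proj v)
    have key := isPreconnected_connectedComponentIn.induction₂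
      (s := connectedComponentIn (inter S) (proj v))
      (fun p q => ∃ u ∈ E.dir S, q = p + proj u) ?_ ?_ ?_ (mem_connectedComponentIn hv) hq
    · obtain ⟨u, hu, rfl⟩ := key
      exact ⟨u, hu, proj_add v u⟩
    · intro p hp
      obtain ⟨w, rfl⟩ := proj_surjective p
      have h1 := (eventually_nhds_proj (v := w) E.eventually_form_eq_zero).filter_mono
        (nhdsWithin_le_nhds (s := connectedComponentIn (inter S) (proj v)))
      filter_upwards [h1, self_mem_nhdsWithin]
      rintro _ ⟨u, hu, rfl⟩ hq'
      refine ⟨u, E.mem_dir.2 fun i hi => hu i ?_, proj_add w u⟩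
      exact E.exists_form_eq_int (hsub hp i hi) (hsub hq' i hi)
    · rintro p _ _ - - - ⟨u, hu, rfl⟩ ⟨w, hw, rfl⟩
      exact ⟨u + w, add_mem hu hw, by rw [proj_add, add_assoc]⟩
    · rintro p _ - - ⟨u, hu, rfl⟩
      refine ⟨-u, neg_mem hu, ?_⟩
      rw [add_assoc, ← proj_add, add_neg_cancel]
      ext; simp [proj]
  · refine IsPreconnected.subset_connectedComponentIn ?_ ⟨0, zero_mem _, by simp⟩ ?_
    · refine (E.dir S).convex.isPreconnected.image _ ?_
      exact (continuous_proj.comp (continuous_const.add continuous_id)).continuousOn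
    · rintro _ ⟨u, hu, rfl⟩ i hi
      exact E.proj_add_mem (hv i hi) (E.mem_dir.1 hu i hi)

/-- The linear direction of a flat. -/
def flatDir (x : Set (Torus n)) : Submodule ℝ (Fin n → ℝ) := E.dir (𝓗.through x)

lemma flatDir_anti {x y : Set (Torus n)} (h : x ⊆ y) : E.flatDir x ≤ E.flatDir y :=
  E.dir_anti fun _ hi => mem_through.2 (h.trans (mem_through.1 hi))

lemma flatDir_le_dir {x : Set (Torus n)} {S : Finset 𝓗.hyperplanes} (h : x ⊆ inter S) :
    E.flatDir x ≤ E.dir S := E.dir_anti (subset_inter_iff.1 h)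

/-- The form of a hyperplane vanishes on the directions of the lines in it: on the small multiples
of such a direction it takes small integral values. -/
lemma form_eq_zero_of_line {v u : Fin n → ℝ} {i : 𝓗.hyperplanes}
    (h : ∀ t : ℝ, proj (v + t • u) ∈ i.1) : E.form i u = 0 := by
  have h0 : proj v ∈ i.1 := by simpa using h 0
  have h1 : ∀ᶠ t : ℝ in 𝓝[≠] 0, E.form i (t • u) = 0 := by
    have hc : Filter.Tendsto (fun t : ℝ => t • u) (𝓝[≠] 0) (𝓝 0) := by
      have : Continuous fun t : ℝ => t • u := by fun_prop
      have := this.tendsto 0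
      rw [zero_smul] at this
      exact this.mono_left nhdsWithin_le_nhds
    filter_upwards [hc.eventually E.eventually_form_eq_zero] with t ht
    exact ht i (E.exists_form_eq_int h0 (h t))
  obtain ⟨t, ht, ht0⟩ := (h1.and self_mem_nhdsWithin).exists
  rw [map_smul, smul_eq_mul] at ht
  exact (mul_eq_zero.1 ht).resolve_left ht0

lemma flatDir_component {S : Finset 𝓗.hyperplanes} {x : Set (Torus n)}
    (hx : x ∈ components (inter S)) : E.flatDir x = E.dir S := by
  obtain ⟨p, hp, rfl⟩ := hx
  obtain ⟨v, rfl⟩ := proj_surjective p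
  refine le_antisymm (E.flatDir_le_dir (connectedComponentIn_subset _ _)) fun u hu => ?_
  refine E.mem_dir.2 fun i hi => E.form_eq_zero_of_line (v := v) fun t => mem_through.1 hi ?_
  rw [E.connectedComponentIn_inter hp]
  exact ⟨t • u, Submodule.smul_mem _ t hu, rfl⟩

/-- A flat is the translate of the image of its direction through any of its points. -/
lemma flat_eq {x : Set (Torus n)} (hx : x ∈ 𝓗.flats) {v : Fin n → ℝ} (hv : proj v ∈ x) :
    x = (fun u => proj (v + u)) '' (E.flatDir x) := by
  rcases mem_flats_iff.1 hx with rfl | ⟨S, hS⟩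
  · exact absurd hv (Set.notMem_empty _)
  · rw [E.flatDir_component hS]
    obtain ⟨p, hp, rfl⟩ := hS
    rw [← E.connectedComponentIn_inter (connectedComponentIn_subset _ _ hv)]
    exact connectedComponentIn_eq hv

lemma flat_eq_of_subset {x y : Set (Torus n)} (hx : x ∈ 𝓗.flats) (hy : y ∈ 𝓗.flats)
    (hne : y.Nonempty) (h : y ⊆ x) (hd : E.flatDir y = E.flatDir x) : y = x := by
  obtain ⟨q, hq⟩ := hne
  obtain ⟨v, rfl⟩ := proj_surjective q
  rw [E.flat_eq hx (h hq), E.flat_eq hy hq, hd]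

/-- The component through `proj v` of the intersection of the hyperplanes in `S`, and its
direction. -/
lemma exists_flat {S : Finset 𝓗.hyperplanes} {v : Fin n → ℝ} (hv : proj v ∈ inter S) :
    ∃ x ∈ 𝓗.flats, x ∈ components (inter S) ∧ x = (fun u => proj (v + u)) '' (E.dir S) ∧
      E.flatDir x = E.dir S := by
  have h : connectedComponentIn (inter S) (proj v) ∈ components (inter S) := ⟨_, hv, rfl⟩
  exact ⟨_, mem_flats_iff.2 (Or.inr ⟨S, h⟩), h, E.connectedComponentIn_inter hv,
    E.flatDir_component h⟩

/-- A subspace whose translate has a single image point in the torus is trivial. -/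
lemma eq_bot_of_subsingleton_image {v : Fin n → ℝ} {W : Submodule ℝ (Fin n → ℝ)}
    (h : ((fun u => proj (v + u)) '' (W : Set (Fin n → ℝ))).Subsingleton) : W = ⊥ := by
  refine (Submodule.eq_bot_iff _).2 fun u hu => ?_
  by_contra hu0
  obtain ⟨j, hj⟩ := Function.ne_iff.1 hu0
  rw [Pi.zero_apply] at hj
  have h1 := h ⟨(1 / (2 * u j)) • u, W.smul_mem _ hu, rfl⟩ ⟨0, W.zero_mem, rfl⟩
  obtain ⟨z, hz⟩ := proj_eq_proj_iff.1 h1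
  have h2 : (1 / 2 : ℝ) = z j := by
    have := congrFun hz j
    simp only [Pi.add_apply, Pi.smul_apply, smul_eq_mul, Pi.zero_apply, latticeVec] at this
    field_simp at this
    linarith
  have h3 : (2 * z j : ℤ) = 1 := by
    have : (2 * z j : ℝ) = 1 := by rw [← h2]; norm_num
    exact_mod_cast this
  omega

/-- A flat has direction `0` if and only if it is a point. -/
lemma flatDir_eq_bot_iff {x : Set (Torus n)} (hx : x ∈ 𝓗.flats) {p : Torus n} (hp : p ∈ x) :
    E.flatDir x = ⊥ ↔ x = {p} := by
  obtain ⟨v, rfl⟩ := proj_surjective p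
  constructor
  · intro h
    rw [E.flat_eq hx hp, h]
    simp
  · intro h
    refine eq_bot_of_subsingleton_image (v := v) ?_
    rw [← E.flat_eq hx hp, h]
    exact Set.subsingleton_singleton

end Equations

end ToricArrangement

/-! ### Möbius function and grading of the intersection poset -/

namespace ToricArr

open Classical in
lemma sum_posetMoebius_bot {P : Type*} [PartialOrder P] [BoundedOrder P] [Fintype P] (x : P) :
    ∑ y : P with y ≤ x, posetMoebius ⊥ y = if x = ⊥ then 1 else 0 := by
  let _ : LocallyFiniteOrder P := Fintype.toLocallyFiniteOrder
  have h := IncidenceAlgebra.sum_Icc_mu_right (𝕜 := ℤ) (⊥ : P) x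
  have h1 : Finset.Icc ⊥ x = Finset.univ.filter fun y => y ≤ x := by
    ext y; simp
  rw [h1] at h
  simp only [eq_comm (a := x)]
  exact h

open Classical in
/-- The recursion for `μ(⊥, ·)` on a lower set determines it there. -/
lemma posetMoebius_bot_eq {P : Type*} [PartialOrder P] [BoundedOrder P] [Fintype P] (f : P → ℤ)
    (L : Set P) (hL : IsLowerSet L)
    (hf : ∀ x ∈ L, ∑ y : P with y ≤ x, f y = if x = ⊥ then 1 else 0) :
    ∀ x ∈ L, posetMoebius ⊥ x = f x := by
  intro x
  induction x using WellFoundedLT.induction with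
  | ind x ih =>
    intro hx
    have h1 := (sum_posetMoebius_bot x).trans (hf x hx).symm
    have h2 : (Finset.univ.filter fun y => y ≤ x) =
        insert x (Finset.univ.filter fun y => y < x) := by
      ext y; simp [le_iff_eq_or_lt]
    rw [h2, Finset.sum_insert (by simp), Finset.sum_insert (by simp)] at h1
    have h3 : ∑ y : P with y < x, posetMoebius ⊥ y = ∑ y : P with y < x, f y := by
      refine Finset.sum_congr rfl fun y hy => ?_
      have hy' := (Finset.mem_filter.1 hy).2
      exact ih y hy' (hL hy'.le hx)
    rw [h3] at h1
    exact add_right_cancel h1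

/-- In a finite poset graded by `ℕ`, the rank of an element is its grade. -/
lemma posetRank_eq_grade {P : Type*} [PartialOrder P] [BoundedOrder P] [Fintype P]
    [GradeMinOrder ℕ P] (x : P) : posetRank x = grade ℕ x := by
  have key : Order.height x = grade ℕ x := by
    apply le_antisymm
    · have := Order.height_le_height_apply_of_strictMono (grade ℕ : P → ℕ) grade_strictMono x
      rwa [Order.height_nat] at this
    · induction x using WellFoundedLT.induction with
      | ind x ih =>
        by_cases hx : IsMin x
        · have := (isMin_iff_eq_bot.1 (hx.grade ℕ))
          simp [this]
        · obtain ⟨y, hy⟩ := exists_covBy_of_wellFoundedGT hx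
          have h1 := Order.covBy_iff_add_one_eq.1 (hy.grade ℕ)
          rw [← h1]
          push_cast
          exact (add_le_add_left (ih y hy.lt) 1).trans (Order.height_add_one_le hy.lt)
  simp [posetRank, key]

end ToricArr

namespace ToricArrangement

open Topology ToricArr

variable {n : ℕ} {𝓗 : ToricArrangement n}

lemma toSet_mem_flats (x : 𝓗.IntersectionPoset) : toSet x ∈ 𝓗.flats := (OrderDual.ofDual x).2

lemma toSet_injective : Function.Injective (toSet (𝓗 := 𝓗)) := fun _ _ h =>
  OrderDual.ofDual.injective (Subtype.ext h)

lemma exists_toSet_eq {x : Set (Torus n)} (hx : x ∈ 𝓗.flats) :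
    ∃ y : 𝓗.IntersectionPoset, toSet y = x := ⟨OrderDual.toDual ⟨x, hx⟩, rfl⟩

lemma le_iff_toSet {x y : 𝓗.IntersectionPoset} : x ≤ y ↔ toSet y ⊆ toSet x := Iff.rfl

lemma lt_iff_toSet {x y : 𝓗.IntersectionPoset} : x < y ↔ toSet y ⊂ toSet x := Iff.rfl

lemma toSet_bot : toSet (⊥ : 𝓗.IntersectionPoset) = Set.univ := rfl

lemma toSet_top : toSet (⊤ : 𝓗.IntersectionPoset) = ∅ := rfl

lemma toSet_eq_empty_iff {x : 𝓗.IntersectionPoset} : toSet x = ∅ ↔ x = ⊤ :=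
  toSet_injective.eq_iff' toSet_top

namespace Equations

variable (E : 𝓗.Equations)

include E

/-- A nonempty flat lies in no hyperplane only if it is the whole torus. -/
lemma through_eq_empty_iff {x : Set (Torus n)} (hx : x ∈ 𝓗.flats) (hne : x.Nonempty) :
    𝓗.through x = ∅ ↔ x = Set.univ := by
  constructor
  · intro h
    refine (E.flat_eq_of_subset 𝓗.univ_mem_flats hx hne (Set.subset_univ x) ?_).trans rfl
    refine le_antisymm (E.flatDir_anti (Set.subset_univ x)) fun u _ => ?_
    rw [flatDir, h]
    exact E.mem_dir.2 (by simp)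
  · rintro rfl
    by_contra h
    obtain ⟨i, hi⟩ := Finset.nonempty_iff_ne_empty.2 h
    refine E.form_ne_zero i (LinearMap.ext fun u => ?_)
    exact E.form_eq_zero_of_line (v := 0) fun t => mem_through.1 hi (Set.mem_univ _)

open Classical in
/-- The Möbius function of the intersection poset as an alternating count of the subarrangements
of whose intersection the given flat is a component. Both sides satisfy the same recursion, as
every flat contained in an intersection lies in exactly one component of it. -/
lemma posetMoebius_eq_sum (x : 𝓗.IntersectionPoset) (hx : toSet x ≠ ∅) :
    posetMoebius ⊥ x = ∑ S : Finset 𝓗.hyperplanes,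
      if toSet x ∈ components (inter S) then (-1) ^ S.card else 0 := by
  refine posetMoebius_bot_eq (fun x => ∑ S : Finset 𝓗.hyperplanes,
      if toSet x ∈ components (inter S) then (-1) ^ S.card else 0)
    {x | toSet x ≠ ∅} ?_ ?_ x hx
  · intro x y hyx hx
    exact ((Set.nonempty_iff_ne_empty.2 hx).mono hyx).ne_empty
  · intro x hx
    obtain ⟨p, hp⟩ := Set.nonempty_iff_ne_empty.2 hx
    obtain ⟨v, rfl⟩ := proj_surjective p
    rw [Finset.sum_comm]
    have key : ∀ S : Finset 𝓗.hyperplanes, (∑ y : 𝓗.IntersectionPoset with y ≤ x,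
        if toSet y ∈ components (inter S) then (-1 : ℤ) ^ S.card else 0) =
        if S ∈ (𝓗.through (toSet x)).powerset then (-1) ^ S.card else 0 := by
      intro S
      by_cases hS : S ⊆ 𝓗.through (toSet x)
      · rw [if_pos (Finset.mem_powerset.2 hS)]
        have hsub := subset_inter_iff.2 hS
        obtain ⟨y, hy, hyS, hyeq, -⟩ := E.exists_flat (hsub hp)
        obtain ⟨y, rfl⟩ := exists_toSet_eq hy
        have hyx : y ≤ x := by
          rw [le_iff_toSet, hyeq, E.flat_eq (toSet_mem_flats x) hp]
          exact Set.image_mono (E.flatDir_le_dir hsub)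
        rw [Finset.sum_eq_single y, if_pos hyS]
        · intro z hz hzy
          refine if_neg fun hzS => hzy (toSet_injective ?_)
          have hzp := (Finset.mem_filter.1 hz).2 hp
          have hd := (E.flatDir_component hzS).trans (E.flatDir_component hyS).symm
          rw [E.flat_eq (toSet_mem_flats z) hzp, E.flat_eq hy (hyx hp), hd]
        · intro h
          exact absurd (Finset.mem_filter.2 ⟨Finset.mem_univ y, hyx⟩) h
      · rw [if_neg fun h => hS (Finset.mem_powerset.1 h)]
        refine Finset.sum_eq_zero fun y hy => if_neg fun hyS => hS ?_
        obtain ⟨q, -, hq⟩ := hyS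
        refine subset_inter_iff.1 ((le_iff_toSet.1 (Finset.mem_filter.1 hy).2).trans ?_)
        rw [hq]
        exact connectedComponentIn_subset _ _
    rw [Finset.sum_congr rfl fun S _ => key S, Finset.sum_ite_mem, Finset.univ_inter,
      Finset.sum_powerset_neg_one_pow_card]
    have hbot : 𝓗.through (toSet x) = ∅ ↔ x = ⊥ := by
      rw [E.through_eq_empty_iff (toSet_mem_flats x) ⟨_, hp⟩]
      exact toSet_injective.eq_iff' toSet_bot
    by_cases hx0 : x = ⊥
    · rw [if_pos hx0, if_pos (hbot.2 hx0)]
    · rw [if_neg hx0, if_neg fun h => hx0 (hbot.1 h)]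

lemma singleton_mem_components_iff {p : Torus n} {S : Finset 𝓗.hyperplanes} :
    {p} ∈ components (inter S) ↔ S ⊆ 𝓗.through {p} ∧ E.dir S = ⊥ := by
  constructor
  · intro h
    refine ⟨?_, ?_⟩
    · obtain ⟨q, -, hq⟩ := h
      refine subset_inter_iff.1 ?_
      rw [hq]
      exact connectedComponentIn_subset _ _
    · rw [← E.flatDir_component h]
      exact (E.flatDir_eq_bot_iff (mem_flats_iff.2 (Or.inr ⟨S, h⟩)) rfl).2 rfl
  · rintro ⟨hS, hd⟩
    obtain ⟨v, rfl⟩ := proj_surjective p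
    obtain ⟨x, -, hxS, hx, -⟩ := E.exists_flat (subset_inter_iff.2 hS rfl)
    rw [hd] at hx
    have : x = {proj v} := by simpa using hx
    rwa [← this]

open Classical in
lemma posetMoebius_point {p : Torus n} {x : 𝓗.IntersectionPoset} (hx : toSet x = {p}) :
    posetMoebius ⊥ x = ∑ S ∈ (𝓗.through {p}).powerset,
      if E.dir S = ⊥ then (-1) ^ S.card else 0 := by
  rw [E.posetMoebius_eq_sum x (by simp [hx]), hx, ← Finset.univ_inter (Finset.powerset _),
    ← Finset.sum_ite_mem]
  refine Finset.sum_congr rfl fun S _ => ?_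
  rw [← ite_and]
  exact if_congr (by rw [E.singleton_mem_components_iff, Finset.mem_powerset]) rfl rfl

lemma singleton_mem_flats_iff {p : Torus n} :
    {p} ∈ 𝓗.flats ↔ E.dir (𝓗.through {p}) = ⊥ := by
  constructor
  · intro h
    exact (E.flatDir_eq_bot_iff h rfl).2 rfl
  · intro h
    exact mem_flats_iff.2 (Or.inr ⟨_, E.singleton_mem_components_iff.2 ⟨subset_rfl, h⟩⟩)

/-- A hyperplane that is not parallel to a flat `x` cuts a smaller flat out of it, through each of
their common points. The direction of the smaller flat has codimension one in that of `x`. -/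
lemma exists_flat_section {x : Set (Torus n)} {v : Fin n → ℝ} (hx : x ∈ 𝓗.flats)
    (hv : proj v ∈ x) {i : 𝓗.hyperplanes} (hi : ∃ u ∈ E.flatDir x, E.form i u ≠ 0)
    (hvi : proj v ∈ i.1) :
    ∃ y ∈ 𝓗.flats, proj v ∈ y ∧ y ⊂ x ∧
      E.flatDir y = E.flatDir x ⊓ LinearMap.ker (E.form i) := by
  classical
  obtain ⟨y, hy, -, hyeq, hyd⟩ := E.exists_flat (S := insert i (𝓗.through x)) (v := v) (by
    intro j hj
    rcases Finset.mem_insert.1 hj with rfl | hj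
    · exact hvi
    · exact mem_through.1 hj hv)
  have hyd' : E.flatDir y = E.flatDir x ⊓ LinearMap.ker (E.form i) := by
    rw [hyd]
    ext u
    simp [flatDir, mem_dir, and_comm]
  have hvy : proj v ∈ y := by
    rw [hyeq]
    exact ⟨0, zero_mem _, by simp⟩
  refine ⟨y, hy, hvy, ⟨?_, fun h => ?_⟩, hyd'⟩
  · rw [E.flat_eq hx hv, E.flat_eq hy hvy, hyd']
    exact Set.image_mono inf_le_left
  · obtain ⟨u, hu, hui⟩ := hi
    have h1 := E.flatDir_anti h hu
    rw [hyd'] at h1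
    exact hui h1.2

/-- The arrangement is essential: the normal vectors of the hyperplanes span. -/
def IsEssential : Prop := E.dir Finset.univ = ⊥

variable {E}

lemma isCoatom_iff (hE : E.IsEssential) {x : 𝓗.IntersectionPoset} :
    IsCoatom x ↔ ∃ p, toSet x = {p} := by
  constructor
  · intro h
    obtain ⟨p, hp⟩ := Set.nonempty_iff_ne_empty.2 fun h0 => h.1 (toSet_eq_empty_iff.1 h0)
    refine ⟨p, (E.flatDir_eq_bot_iff (toSet_mem_flats x) hp).1 ?_⟩
    obtain ⟨v, rfl⟩ := proj_surjective p
    by_contra hne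
    obtain ⟨u, hu, hu0⟩ := Submodule.exists_mem_ne_zero_of_ne_bot hne
    obtain ⟨i, hi⟩ : ∃ i, E.form i u ≠ 0 := by
      by_contra! hc
      have h1 : u ∈ E.dir Finset.univ := E.mem_dir.2 fun i _ => hc i
      rw [hE] at h1
      exact hu0 (by simpa using h1)
    -- Moving along `u` inside the flat leads to a point of the hyperplane `i`.
    let w := ((E.const i - E.form i v) / E.form i u) • u
    have hw : proj (v + w) ∈ toSet x := by
      rw [E.flat_eq (toSet_mem_flats x) hp]
      exact ⟨w, Submodule.smul_mem _ _ hu, rfl⟩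
    have hwi : proj (v + w) ∈ i.1 := by
      refine (E.proj_mem_iff i _).2 ⟨0, ?_⟩
      simp only [w, map_add, map_smul, smul_eq_mul]
      field_simp
      simp
    obtain ⟨y, hy, hvy, hyx, -⟩ := E.exists_flat_section (toSet_mem_flats x) hw ⟨u, hu, hi⟩ hwi
    obtain ⟨y, rfl⟩ := exists_toSet_eq hy
    have h1 := h.2 y hyx
    rw [h1, toSet_top] at hvy
    exact hvy
  · rintro ⟨p, hp⟩
    refine ⟨fun h => by simp [h, toSet_top] at hp, fun y hy => ?_⟩
    rw [lt_iff_toSet, hp, Set.ssubset_singleton_iff] at hy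
    exact toSet_eq_empty_iff.1 hy

variable (E)

open Classical in
/-- The codimension of a flat, with the value `n + 1` for the empty set. -/
def codim (x : 𝓗.IntersectionPoset) : ℕ :=
  if x = ⊤ then n + 1 else n - Module.finrank ℝ (E.flatDir (toSet x))

lemma codim_point {x : 𝓗.IntersectionPoset} {p : Torus n} (hx : toSet x = {p}) :
    E.codim x = n := by
  have h1 : x ≠ ⊤ := fun h => by simp [h, toSet_top] at hx
  have h2 := (E.flatDir_eq_bot_iff (toSet_mem_flats x) (p := p) (by simp [hx])).2 hx
  rw [codim, if_neg h1, h2, finrank_bot, Nat.sub_zero]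

lemma finrank_flatDir_le (x : Set (Torus n)) : Module.finrank ℝ (E.flatDir x) ≤ n := by
  simpa using Submodule.finrank_le (E.flatDir x)

/-- The grading of the intersection poset of an essential arrangement by codimension. -/
abbrev gradeMinOrder (hE : E.IsEssential) : GradeMinOrder ℕ 𝓗.IntersectionPoset where
  grade := E.codim
  grade_strictMono := by
    intro x y hxy
    have hx : x ≠ ⊤ := (hxy.trans_le le_top).ne
    by_cases hy : y = ⊤
    · simp only [codim, hx, hy, if_true, if_false]
      omega
    · simp only [codim, hx, hy, if_false]
      have hlt : E.flatDir (toSet y) < E.flatDir (toSet x) := by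
        refine (E.flatDir_anti hxy.le).lt_of_ne fun h => hxy.ne' (toSet_injective ?_)
        exact E.flat_eq_of_subset (toSet_mem_flats x) (toSet_mem_flats y)
          (Set.nonempty_iff_ne_empty.2 fun h0 => hy (toSet_eq_empty_iff.1 h0)) hxy.le h
      have h1 := Submodule.finrank_lt_finrank_of_lt hlt
      have h2 := E.finrank_flatDir_le (toSet x)
      omega
  covBy_grade := by
    intro x y hxy
    rw [Order.covBy_iff_add_one_eq]
    have hx : x ≠ ⊤ := (hxy.lt.trans_le le_top).ne
    by_cases hy : y = ⊤
    · subst hy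
      obtain ⟨p, hp⟩ := (isCoatom_iff hE).1 (covBy_top_iff.1 hxy)
      rw [E.codim_point hp]
      simp [codim]
    · obtain ⟨q, hq⟩ := Set.nonempty_iff_ne_empty.2 fun h0 => hy (toSet_eq_empty_iff.1 h0)
      obtain ⟨v, rfl⟩ := proj_surjective q
      have hne : E.flatDir (toSet y) ≠ E.flatDir (toSet x) := fun h =>
        hxy.lt.ne' (toSet_injective (E.flat_eq_of_subset (toSet_mem_flats x) (toSet_mem_flats y)
          ⟨_, hq⟩ hxy.lt.le h))
      -- A hyperplane through `y` that is not parallel to `x` cuts out a flat between them.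
      obtain ⟨i, hi, hix⟩ : ∃ i ∈ 𝓗.through (toSet y), ∃ u ∈ E.flatDir (toSet x),
          E.form i u ≠ 0 := by
        by_contra! hc
        exact hne (le_antisymm (E.flatDir_anti hxy.lt.le) fun u hu =>
          E.mem_dir.2 fun i hi => hc i hi u hu)
      obtain ⟨z, hz, hvz, hzx, hzd⟩ := E.exists_flat_section (toSet_mem_flats x)
        (hxy.lt.le hq) hix (mem_through.1 hi hq)
      obtain ⟨z, rfl⟩ := exists_toSet_eq hz
      have hyz : toSet y ⊆ toSet z := by
        rw [E.flat_eq (toSet_mem_flats y) hq, E.flat_eq hz hvz, hzd]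
        exact Set.image_mono fun u hu =>
          ⟨E.flatDir_anti hxy.lt.le hu, E.mem_dir.1 hu i hi⟩
      have hzy : z = y := (le_iff_toSet.2 hyz).eq_of_not_lt fun h => hxy.2 hzx h
      subst hzy
      simp only [codim, hx, hy, if_false]
      have h1 := finrank_inf_ker hix
      rw [← hzd] at h1
      have h2 := E.finrank_flatDir_le (toSet x)
      omega
  isMin_grade := by
    intro x hx
    have hx' : x = ⊥ := isMin_iff_eq_bot.1 hx
    have h0 : E.codim x = 0 := by
      have h1 : (⊥ : 𝓗.IntersectionPoset) ≠ ⊤ := fun h => by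
        have h2 := congrArg toSet h
        rw [toSet_bot, toSet_top] at h2
        exact Set.empty_ne_univ h2.symm
      have h2 := (E.through_eq_empty_iff 𝓗.univ_mem_flats Set.univ_nonempty).2 rfl
      have h3 : E.flatDir Set.univ = ⊤ := by
        rw [flatDir, h2]
        exact eq_top_iff.2 fun u _ => E.mem_dir.2 (by simp)
      rw [hx', codim, if_neg h1, toSet_bot, h3]
      simp
    rw [h0]
    exact isMin_bot

/-- The forms have integral coefficients. -/
lemma exists_coeff : ∃ k : 𝓗.hyperplanes → Fin n → ℤ,
    ∀ i u, E.form i u = ∑ j, (k i j : ℝ) * u j := by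
  choose k hk using fun i (j : Fin n) => E.form_latticeVec i (Pi.single j 1)
  refine ⟨k, fun i u => ?_⟩
  conv_lhs => rw [← Finset.univ_sum_single u]
  rw [map_sum]
  refine Finset.sum_congr rfl fun j _ => ?_
  have : (Pi.single j (u j) : Fin n → ℝ) = u j • latticeVec (Pi.single j 1) := by
    ext l
    by_cases h : l = j
    · subst h; simp [latticeVec]
    · simp [latticeVec, h]
  rw [this, map_smul, hk, smul_eq_mul, mul_comm]

/-- A flat is a toric subspace. -/
lemma isToricSubspace_flat {x : Set (Torus n)} (hx : x ∈ 𝓗.flats) (hne : x.Nonempty) :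
    IsToricSubspace (Module.finrank ℝ (E.flatDir x)) x := by
  obtain ⟨p, hp⟩ := hne
  obtain ⟨v, rfl⟩ := proj_surjective p
  obtain ⟨k, hform⟩ := E.exists_coeff
  let e := (𝓗.through x).equivFin.symm
  refine ⟨AffineSubspace.mk' v (E.flatDir x), AffineSubspace.mk'_nonempty _ _,
    ⟨_, Matrix.of fun r j => (k (e r) j : ℚ), fun r => E.form (e r) v, fun w => ?_⟩, ?_, ?_⟩
  · rw [AffineSubspace.mem_mk', vsub_eq_sub, flatDir, mem_dir]
    have h1 : ∀ r, (Matrix.map (Matrix.of fun r j => (k (e r) j : ℚ))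
        (fun q : ℚ => (q : ℝ))).mulVec w r = E.form (e r) w := by
      intro r
      simp [Matrix.mulVec, dotProduct, hform]
    constructor
    · intro h
      ext r
      have := h _ (e r).2
      rw [map_sub, sub_eq_zero] at this
      rw [h1, this]
    · intro h i hi
      have := congrFun h (e.symm ⟨i, hi⟩)
      rw [h1, Equiv.apply_symm_apply] at this
      rw [map_sub, this, sub_self]
  · rw [AffineSubspace.direction_mk']
  · conv_lhs => rw [E.flat_eq hx hp]
    ext q
    simp only [Set.mem_image, SetLike.mem_coe, AffineSubspace.mem_mk', vsub_eq_sub]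
    constructor
    · rintro ⟨u, hu, rfl⟩
      exact ⟨v + u, by simpa using hu, rfl⟩
    · rintro ⟨w, hw, rfl⟩
      exact ⟨w - v, hw, by simp⟩

lemma toricDim_eq_zero_iff {x : Set (Torus n)} (hx : x ∈ 𝓗.flats) {p : Torus n} (hp : p ∈ x) :
    toricDim x = 0 ↔ x = {p} := by
  have hT := E.isToricSubspace_flat hx ⟨p, hp⟩
  constructor
  · intro h
    rcases Nat.sInf_eq_zero.1 h with ⟨V, -, -, hdim, hxV⟩ | h0
    · have hbot : V.direction = ⊥ := Submodule.finrank_eq_zero.1 hdim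
      have hsub : x.Subsingleton := by
        rw [hxV]
        refine Set.Subsingleton.image (fun v hv w hw => ?_) _
        have := V.vsub_mem_direction hv hw
        rw [hbot, Submodule.mem_bot, vsub_eq_zero_iff_eq] at this
        exact this
      exact hsub.eq_singleton_of_mem hp
    · exact absurd hT (by rw [Set.eq_empty_iff_forall_notMem] at h0; exact h0 _)
  · intro h
    rw [(E.flatDir_eq_bot_iff hx hp).2 h, finrank_bot] at hT
    exact Nat.sInf_eq_zero.2 (Or.inl hT)

end Equations

end ToricArrangement

/-! ### Arrangements whose regions are open balls are essential -/

namespace ToricArrangement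

open Topology ToricArr

variable {n : ℕ} {𝓗 : ToricArrangement n}

lemma mem_complement_iff {q : Torus n} :
    q ∈ 𝓗.complement ↔ ∀ i : 𝓗.hyperplanes, q ∉ i.1 := by
  simp [complement]

namespace Equations

variable (E : 𝓗.Equations)

/-- If the normal vectors do not span, they are all orthogonal to a nonzero lattice vector: the
Gram matrix of their coordinates is integral and singular. -/
lemma exists_latticeVec_of_not_isEssential (hE : ¬ E.IsEssential) :
    ∃ z : Fin n → ℤ, z ≠ 0 ∧ ∀ i, E.form i (latticeVec z) = 0 := by
  obtain ⟨u, hu, hu0⟩ := Submodule.exists_mem_ne_zero_of_ne_bot hE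
  obtain ⟨k, hk⟩ := E.exists_coeff
  let K : Matrix 𝓗.hyperplanes (Fin n) ℤ := Matrix.of k
  have hKu : (K.map (Int.castRingHom ℝ)).mulVec u = 0 := by
    ext i
    have := E.mem_dir.1 hu i (Finset.mem_univ i)
    rw [hk] at this
    simpa [K, Matrix.mulVec, dotProduct] using this
  have hdet : (K.transpose * K).det = 0 := by
    have h1 : ((K.transpose * K).map (Int.castRingHom ℝ)).det = 0 := by
      refine Matrix.exists_mulVec_eq_zero_iff.1 ⟨u, hu0, ?_⟩
      rw [Matrix.map_mul, ← Matrix.mulVec_mulVec, hKu, Matrix.mulVec_zero]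
    have h2 := (Int.castRingHom ℝ).map_det (K.transpose * K)
    rw [RingHom.mapMatrix_apply, h1] at h2
    simpa using h2
  obtain ⟨z, hz0, hz⟩ := Matrix.exists_mulVec_eq_zero_iff.2 hdet
  refine ⟨z, hz0, fun i => ?_⟩
  have hKz : K.mulVec z = 0 := by
    have h1 : K.mulVec z ⬝ᵥ K.mulVec z = 0 := by
      rw [← Matrix.mulVec_mulVec] at hz
      rw [Matrix.dotProduct_mulVec, ← Matrix.mulVec_transpose, hz, zero_dotProduct]
    exact dotProduct_self_eq_zero.1 h1
  have h2 : ∑ j, k i j * z j = 0 := congrFun hKz i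
  rw [hk]
  simp only [latticeVec]
  exact_mod_cast h2

include E in
lemma exists_proj_mem_complement : ∃ v : Fin n → ℝ, proj v ∈ 𝓗.complement := by
  obtain ⟨u, hu⟩ := Module.Dual.exists_forall_ne_zero_of_forall_exists E.form fun i => by
    by_contra! h
    exact E.form_ne_zero i (LinearMap.ext h)
  -- A line in the direction `u` meets the hyperplanes in countably many points.
  have hcount : (⋃ (i : 𝓗.hyperplanes) (k : ℤ), {(E.const i + k) / E.form i u}).Countable :=
    Set.countable_iUnion fun i => Set.countable_iUnion fun k => Set.countable_singleton _
  obtain ⟨t, ht⟩ := (Set.ne_univ_iff_exists_notMem _).1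
    fun h => Set.not_countable_univ (α := ℝ) (h ▸ hcount)
  refine ⟨t • u, mem_complement_iff.2 fun i hi => ht ?_⟩
  obtain ⟨k, hk⟩ := (E.proj_mem_iff i _).1 hi
  simp only [Set.mem_iUnion, Set.mem_singleton_iff]
  refine ⟨i, k, ?_⟩
  rw [map_smul, smul_eq_mul] at hk
  rw [← hk]
  field_simp [hu i]

include E in
/-- If the arrangement is not essential, a region contains a translate of the image of a line
through a nonzero lattice vector. This loop has nonzero winding number in some coordinate, but the
coordinates of a region homeomorphic to a ball lift to real-valued functions. -/
lemma isEssential (h : 𝓗.RegionsAreOpenBalls) : E.IsEssential := by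
  by_contra hE
  obtain ⟨z, hz0, hz⟩ := E.exists_latticeVec_of_not_isEssential hE
  obtain ⟨j, hj⟩ := Function.ne_iff.1 hz0
  obtain ⟨v, hv⟩ := E.exists_proj_mem_complement
  obtain ⟨h⟩ := h (connectedComponentIn 𝓗.complement (proj v)) ⟨_, hv, rfl⟩
  have hγc : Continuous fun t : ℝ => proj (v + t • latticeVec z) :=
    continuous_proj.comp (by fun_prop)
  have hγ : ∀ t : ℝ, proj (v + t • latticeVec z) ∈ connectedComponentIn 𝓗.complement (proj v) := by
    intro t
    refine (isPreconnected_range hγc).subset_connectedComponentIn ⟨0, by simp⟩ ?_ ⟨t, rfl⟩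
    rintro _ ⟨t, rfl⟩
    refine mem_complement_iff.2 fun i hi => mem_complement_iff.1 hv i ?_
    have := E.proj_add_mem (w := -(t • latticeVec z)) hi (by simp [hz i])
    simpa using this
  let B := Metric.ball (0 : EuclideanSpace ℝ (Fin n)) 1
  let γ : ℝ → B := fun t => h ⟨_, hγ t⟩
  have hγ' : Continuous γ := h.continuous.comp (hγc.subtype_mk _)
  have : ContractibleSpace B := (convex_ball _ _).contractibleSpace ⟨0, by simp⟩
  have : LocallyPathConnectedSpace B := Metric.isOpen_ball.locallyPathConnectedSpace
  let f : C(B, UnitAddCircle) := ⟨fun b => (h.symm b).1 j,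
    (continuous_apply j).comp (continuous_subtype_val.comp h.symm.continuous)⟩
  have hf : ∀ t, f (γ t) = ((v j + t * z j : ℝ) : UnitAddCircle) := fun t => by
    simp only [f, γ, ContinuousMap.coe_mk, Homeomorph.symm_apply_apply]
    rfl
  obtain ⟨F, ⟨hF0, hF⟩, -⟩ := (AddCircle.isCoveringMap_coe (1 : ℝ)).existsUnique_continuousMap_lifts
    f (γ 0) (v j) (by rw [hf]; simp)
  have hFγ : (fun t => F (γ t)) = fun t => v j + t * z j := by
    refine (AddCircle.isCoveringMap_coe (1 : ℝ)).eq_of_comp_eq (F.continuous.comp hγ')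
      (by fun_prop) ?_ 0 (by simp [hF0])
    ext1 t
    exact (congrFun hF (γ t)).trans (hf t)
  have hloop : γ 1 = γ 0 := by
    simp only [γ]
    congr 2
    rw [one_smul, zero_smul, add_zero, proj_add_latticeVec]
  have h1 := congrFun hFγ 1
  simp only [hloop, hF0] at h1
  refine hj ?_
  have : (z j : ℝ) = 0 := by linarith
  exact_mod_cast this

end Equations

end ToricArrangement

/-! ### Regions as images of polytopes -/

namespace ToricArrangement

open Topology ToricArr

variable {n : ℕ} {𝓗 : ToricArrangement n}

namespace Equations

variable (E : 𝓗.Equations)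

/-- The open polytope `m i < form i x - const i < m i + 1` of `ℝⁿ`. -/
def openCell (m : 𝓗.hyperplanes → ℤ) : Set (Fin n → ℝ) :=
  {x | ∀ i, m i < E.form i x - E.const i ∧ E.form i x - E.const i < m i + 1}

/-- The closed polytope `m i ≤ form i x - const i ≤ m i + 1` of `ℝⁿ`. -/
def closedCell (m : 𝓗.hyperplanes → ℤ) : Set (Fin n → ℝ) :=
  {x | ∀ i, m i ≤ E.form i x - E.const i ∧ E.form i x - E.const i ≤ m i + 1}

/-- The index of the cell that contains `v`. -/
def cell (v : Fin n → ℝ) (i : 𝓗.hyperplanes) : ℤ := ⌊E.form i v - E.const i⌋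

/-- The integral values of the forms on a lattice vector. -/
def shift (z : Fin n → ℤ) (i : 𝓗.hyperplanes) : ℤ := (E.form_latticeVec i z).choose

lemma form_latticeVec_eq (z : Fin n → ℤ) (i : 𝓗.hyperplanes) :
    E.form i (latticeVec z) = E.shift z i := (E.form_latticeVec i z).choose_spec

lemma openCell_subset_closedCell (m : 𝓗.hyperplanes → ℤ) : E.openCell m ⊆ E.closedCell m :=
  fun _ hx i => ⟨(hx i).1.le, (hx i).2.le⟩

lemma isOpen_openCell (m : 𝓗.hyperplanes → ℤ) : IsOpen (E.openCell m) := by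
  have : E.openCell m = ⋂ i, {x | m i < E.form i x - E.const i ∧
      E.form i x - E.const i < m i + 1} := by ext; simp [openCell]
  rw [this]
  refine isOpen_iInter_of_finite fun i => ?_
  have hc : Continuous fun x => E.form i x - E.const i := (E.continuous_form i).sub continuous_const
  exact (isOpen_lt continuous_const hc).inter (isOpen_lt hc continuous_const)

lemma convex_openCell (m : 𝓗.hyperplanes → ℤ) : Convex ℝ (E.openCell m) := by
  have : E.openCell m = ⋂ i, ({x | m i + E.const i < E.form i x} ∩
      {x | E.form i x < m i + 1 + E.const i}) := by
    ext x
    simp only [openCell, Set.mem_ofPred_eq, Set.mem_iInter, Set.mem_inter_iff, lt_sub_iff_add_lt,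
      sub_lt_iff_lt_add]
  rw [this]
  exact convex_iInter fun i => (convex_halfSpace_gt (E.form i).isLinear _).inter
    (convex_halfSpace_lt (E.form i).isLinear _)

lemma proj_mem_iff_cell {i : 𝓗.hyperplanes} {v : Fin n → ℝ} :
    proj v ∈ i.1 ↔ (E.cell v i : ℝ) = E.form i v - E.const i := by
  rw [E.proj_mem_iff]
  constructor
  · rintro ⟨k, hk⟩
    simp [cell, hk]
  · intro h
    exact ⟨E.cell v i, by linarith⟩

lemma mem_openCell_cell {v : Fin n → ℝ} (hv : proj v ∈ 𝓗.complement) :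
    v ∈ E.openCell (E.cell v) := fun i =>
  ⟨lt_of_le_of_ne (Int.floor_le _) fun h => mem_complement_iff.1 hv i (E.proj_mem_iff_cell.2 h),
    Int.lt_floor_add_one _⟩

lemma cell_eq_of_mem_openCell {m : 𝓗.hyperplanes → ℤ} {v : Fin n → ℝ} (hv : v ∈ E.openCell m) :
    E.cell v = m :=
  funext fun i => Int.floor_eq_iff.2 ⟨(hv i).1.le, (hv i).2⟩

lemma proj_mem_complement_of_mem_openCell {m : 𝓗.hyperplanes → ℤ} {v : Fin n → ℝ}
    (hv : v ∈ E.openCell m) : proj v ∈ 𝓗.complement := mem_complement_iff.2 fun i hi => by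
  rw [E.proj_mem_iff_cell, E.cell_eq_of_mem_openCell hv] at hi
  exact (hv i).1.ne hi

lemma cell_add_latticeVec (v : Fin n → ℝ) (z : Fin n → ℤ) :
    E.cell (v + latticeVec z) = E.cell v + E.shift z := by
  ext i
  simp only [cell, map_add, form_latticeVec_eq, Pi.add_apply]
  rw [add_sub_right_comm, Int.floor_add_intCast]

lemma add_latticeVec_mem_openCell {m : 𝓗.hyperplanes → ℤ} {v : Fin n → ℝ} {z : Fin n → ℤ} :
    v + latticeVec z ∈ E.openCell (m + E.shift z) ↔ v ∈ E.openCell m := by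
  refine forall_congr' fun i => ?_
  simp only [map_add, form_latticeVec_eq, Pi.add_apply, Int.cast_add]
  constructor <;> rintro ⟨h1, h2⟩ <;> constructor <;> linarith

lemma add_latticeVec_mem_closedCell {m : 𝓗.hyperplanes → ℤ} {v : Fin n → ℝ} {z : Fin n → ℤ} :
    v + latticeVec z ∈ E.closedCell (m + E.shift z) ↔ v ∈ E.closedCell m := by
  refine forall_congr' fun i => ?_
  simp only [map_add, form_latticeVec_eq, Pi.add_apply, Int.cast_add]
  constructor <;> rintro ⟨h1, h2⟩ <;> constructor <;> linarith

/-- The connected components of the complement are the images of the open cells: the points of the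
complement whose lifts lie in a given cell, up to lattice translations, form an open set. -/
lemma connectedComponentIn_complement {m : 𝓗.hyperplanes → ℤ} {v : Fin n → ℝ}
    (hv : v ∈ E.openCell m) :
    connectedComponentIn 𝓗.complement (proj v) = proj '' E.openCell m := by
  apply Set.Subset.antisymm
  · intro q hq
    have hsub := connectedComponentIn_subset 𝓗.complement (proj v)
    have key := isPreconnected_connectedComponentIn.induction₂
      (s := connectedComponentIn 𝓗.complement (proj v))
      (fun p q => ∃ v w, proj v = p ∧ proj w = q ∧ E.cell v = E.cell w) ?_ ?_ ?_
      (mem_connectedComponentIn (E.proj_mem_complement_of_mem_openCell hv)) hq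
    · obtain ⟨v', w, hv', rfl, hw⟩ := key
      obtain ⟨z, rfl⟩ := proj_eq_proj_iff.1 hv'.symm
      refine ⟨w + latticeVec z, ?_, proj_add_latticeVec w z⟩
      have h1 := E.mem_openCell_cell (v := w + latticeVec z)
        (by rw [proj_add_latticeVec]; exact hsub hq)
      rwa [cell_add_latticeVec, ← hw, ← cell_add_latticeVec, E.cell_eq_of_mem_openCell hv] at h1
    · intro p hp
      obtain ⟨w, rfl⟩ := proj_surjective p
      have h1 : ∀ᶠ u in 𝓝 (0 : Fin n → ℝ), w + u ∈ E.openCell (E.cell w) := by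
        have hc : Continuous fun u : Fin n → ℝ => w + u := by fun_prop
        refine hc.continuousAt.eventually_mem ((E.isOpen_openCell _).mem_nhds ?_)
        simpa using E.mem_openCell_cell (hsub hp)
      filter_upwards [(eventually_nhds_proj h1).filter_mono nhdsWithin_le_nhds]
      rintro _ ⟨u, hu, rfl⟩
      exact ⟨w, w + u, rfl, rfl, (E.cell_eq_of_mem_openCell hu).symm⟩
    · rintro _ _ _ - - - ⟨v₁, v₂, rfl, rfl, h₁⟩ ⟨w₁, w₂, hw₁, rfl, h₂⟩
      obtain ⟨z, rfl⟩ := proj_eq_proj_iff.1 hw₁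
      refine ⟨v₁ + latticeVec z, w₂, proj_add_latticeVec _ _, rfl, ?_⟩
      rw [← h₂, cell_add_latticeVec, cell_add_latticeVec, h₁]
    · rintro _ _ - - ⟨v₁, v₂, rfl, rfl, h⟩
      exact ⟨v₂, v₁, rfl, rfl, h.symm⟩
  · refine IsPreconnected.subset_connectedComponentIn ?_ ⟨v, hv, rfl⟩ ?_
    · exact (E.convex_openCell m).isPreconnected.image _ continuous_proj.continuousOn
    · rintro _ ⟨w, hw, rfl⟩
      exact E.proj_mem_complement_of_mem_openCell hw

lemma mem_regions_iff {R : Set (Torus n)} :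
    R ∈ 𝓗.regions ↔ ∃ m, (E.openCell m).Nonempty ∧ R = proj '' E.openCell m := by
  constructor
  · rintro ⟨p, hp, rfl⟩
    obtain ⟨v, rfl⟩ := proj_surjective p
    have hv := E.mem_openCell_cell hp
    exact ⟨_, ⟨v, hv⟩, E.connectedComponentIn_complement hv⟩
  · rintro ⟨m, ⟨v, hv⟩, rfl⟩
    exact ⟨proj v, E.proj_mem_complement_of_mem_openCell hv,
      (E.connectedComponentIn_complement hv).symm⟩

lemma image_openCell_eq_iff {m m' : 𝓗.hyperplanes → ℤ} (hm : (E.openCell m).Nonempty) :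
    proj '' E.openCell m = proj '' E.openCell m' ↔ ∃ z, m' = m + E.shift z := by
  constructor
  · intro h
    obtain ⟨v, hv⟩ := hm
    obtain ⟨w, hw, hwv⟩ := h.subset ⟨v, hv, rfl⟩
    obtain ⟨z, rfl⟩ := proj_eq_proj_iff.1 hwv
    refine ⟨z, ?_⟩
    rw [← E.cell_eq_of_mem_openCell hw, cell_add_latticeVec, E.cell_eq_of_mem_openCell hv]
  · rintro ⟨z, rfl⟩
    ext q
    constructor
    · rintro ⟨v, hv, rfl⟩
      exact ⟨v + latticeVec z, E.add_latticeVec_mem_openCell.2 hv, proj_add_latticeVec v z⟩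
    · rintro ⟨v, hv, rfl⟩
      refine ⟨v - latticeVec z, (E.add_latticeVec_mem_openCell (z := z)).1 (by simpa using hv), ?_⟩
      rw [← proj_add_latticeVec _ z, sub_add_cancel]

/-! ### The lowest vertex of a region -/

variable {E} {ℓ : (Fin n → ℝ) →ₗ[ℝ] ℝ} {m : 𝓗.hyperplanes → ℤ} {v w : Fin n → ℝ}

variable (E ℓ m v) in
/-- `v` is a point of the closed cell at which `ℓ` is minimal. -/
def IsLowest : Prop := v ∈ E.closedCell m ∧ ∀ y ∈ E.closedCell m, ℓ v ≤ ℓ y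

variable (E m v) in
open Classical in
/-- The hyperplanes through `proj v` on whose positive side the cell lies. -/
def sides : Finset 𝓗.hyperplanes :=
  (𝓗.through {proj v}).filter fun i => (m i : ℝ) = E.form i v - E.const i

lemma sides_subset : E.sides m v ⊆ 𝓗.through {proj v} := Finset.filter_subset _ _

lemma form_sub_const_of_notMem_sides (hv : v ∈ E.closedCell m) {i : 𝓗.hyperplanes}
    (hi : i ∈ 𝓗.through {proj v}) (his : i ∉ E.sides m v) :
    E.form i v - E.const i = m i + 1 := by
  have h1 : (m i : ℝ) ≠ E.form i v - E.const i := fun h => his (Finset.mem_filter.2 ⟨hi, h⟩)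
  have h2 := E.proj_mem_iff_cell.1 (mem_through_singleton.1 hi)
  have h3 := hv i
  rw [← h2] at h1 h3 ⊢
  have h4 : m i ≤ E.cell v i ∧ E.cell v i ≤ m i + 1 := by exact_mod_cast h3
  have h5 : m i ≠ E.cell v i := by exact_mod_cast h1
  have h6 : E.cell v i = m i + 1 := by omega
  exact_mod_cast h6

lemma strict_of_notMem_through (hv : v ∈ E.closedCell m) {i : 𝓗.hyperplanes}
    (hi : i ∉ 𝓗.through {proj v}) :
    m i < E.form i v - E.const i ∧ E.form i v - E.const i < m i + 1 := by
  have h : ∀ k : ℤ, E.form i v - E.const i ≠ k := fun k hk =>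
    hi (mem_through_singleton.2 ((E.proj_mem_iff i v).2 ⟨k, by linarith⟩))
  refine ⟨(hv i).1.lt_of_ne fun h' => h _ h'.symm, (hv i).2.lt_of_ne fun h' => h (m i + 1) ?_⟩
  rw [h']; push_cast; rfl

lemma signed_apply_of_mem {T : Finset 𝓗.hyperplanes} {i : 𝓗.hyperplanes} (hi : i ∈ T) :
    signed E.form T i w = E.form i w := by simp [signed, hi]

lemma signed_apply_of_notMem {T : Finset 𝓗.hyperplanes} {i : 𝓗.hyperplanes} (hi : i ∉ T) :
    signed E.form T i w = -E.form i w := by simp [signed, hi]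

lemma form_of_mem_sides {i : 𝓗.hyperplanes} (hi : i ∈ E.sides m v) :
    (m i : ℝ) = E.form i v - E.const i := (Finset.mem_filter.1 hi).2

lemma signed_sub_nonneg (hv : v ∈ E.closedCell m) (hw : w ∈ E.closedCell m)
    {i : 𝓗.hyperplanes} (hi : i ∈ 𝓗.through {proj v}) :
    0 ≤ signed E.form (E.sides m v) i (w - v) := by
  by_cases his : i ∈ E.sides m v
  · rw [signed_apply_of_mem his, map_sub]
    linarith [(hw i).1, form_of_mem_sides his]
  · rw [signed_apply_of_notMem his, map_sub]
    linarith [(hw i).2, form_sub_const_of_notMem_sides hv hi his]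

lemma signed_sub_pos (hv : v ∈ E.closedCell m) (hw : w ∈ E.openCell m)
    {i : 𝓗.hyperplanes} (hi : i ∈ 𝓗.through {proj v}) :
    0 < signed E.form (E.sides m v) i (w - v) := by
  by_cases his : i ∈ E.sides m v
  · rw [signed_apply_of_mem his, map_sub]
    linarith [(hw i).1, form_of_mem_sides his]
  · rw [signed_apply_of_notMem his, map_sub]
    linarith [(hw i).2, form_sub_const_of_notMem_sides hv hi his]

/-- For small `t`, the value of a form at `v + t • w` stays between the bounds of the cell if it
lies strictly between them at `v`. -/
lemma eventually_strict {i : 𝓗.hyperplanes}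
    (h : m i < E.form i v - E.const i ∧ E.form i v - E.const i < m i + 1) :
    ∀ᶠ t : ℝ in 𝓝[>] 0, m i < E.form i (v + t • w) - E.const i ∧
      E.form i (v + t • w) - E.const i < m i + 1 := by
  have hc : Continuous fun t : ℝ => E.form i (v + t • w) - E.const i := by
    simp only [map_add, map_smul, smul_eq_mul]; fun_prop
  have h1 := hc.tendsto 0
  simp only [zero_smul, add_zero] at h1
  exact ((h1.eventually (lt_mem_nhds h.1)).and (h1.eventually (gt_mem_nhds h.2))).filter_mono
    nhdsWithin_le_nhds

/-- Small positive multiples of any number are less than `1`. -/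
lemma eventually_mul_lt_one (r : ℝ) : ∀ᶠ t : ℝ in 𝓝[>] 0, t * r < 1 := by
  have hc : Continuous fun t : ℝ => t * r := by fun_prop
  have h1 := hc.tendsto 0
  simp only [zero_mul] at h1
  exact (h1.eventually (gt_mem_nhds one_pos)).filter_mono nhdsWithin_le_nhds

lemma eventually_mem_closedCell (hv : v ∈ E.closedCell m)
    (hw : ∀ i ∈ 𝓗.through {proj v}, 0 ≤ signed E.form (E.sides m v) i w) :
    ∀ᶠ t : ℝ in 𝓝[>] 0, v + t • w ∈ E.closedCell m := by
  refine Filter.eventually_all.2 fun i => ?_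
  by_cases hi : i ∈ 𝓗.through {proj v}
  · filter_upwards [self_mem_nhdsWithin, eventually_mul_lt_one (signed E.form (E.sides m v) i w)]
      with t ht ht1
    have ht0 := mul_nonneg (le_of_lt ht) (hw i hi)
    rw [map_add, map_smul, smul_eq_mul]
    by_cases his : i ∈ E.sides m v
    · rw [signed_apply_of_mem his] at ht0 ht1
      have := form_of_mem_sides his
      constructor <;> linarith
    · rw [signed_apply_of_notMem his] at ht0 ht1
      have := form_sub_const_of_notMem_sides hv hi his
      constructor <;> linarith
  · filter_upwards [eventually_strict (w := w) (strict_of_notMem_through hv hi)] with t ht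
    exact ⟨ht.1.le, ht.2.le⟩

lemma eventually_mem_openCell (hv : v ∈ E.closedCell m)
    (hw : ∀ i ∈ 𝓗.through {proj v}, 0 < signed E.form (E.sides m v) i w) :
    ∀ᶠ t : ℝ in 𝓝[>] 0, v + t • w ∈ E.openCell m := by
  refine Filter.eventually_all.2 fun i => ?_
  by_cases hi : i ∈ 𝓗.through {proj v}
  · filter_upwards [self_mem_nhdsWithin, eventually_mul_lt_one (signed E.form (E.sides m v) i w)]
      with t ht ht1
    have ht0 := mul_pos ht (hw i hi)
    rw [map_add, map_smul, smul_eq_mul]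
    by_cases his : i ∈ E.sides m v
    · rw [signed_apply_of_mem his] at ht0 ht1
      have := form_of_mem_sides his
      constructor <;> linarith
    · rw [signed_apply_of_notMem his] at ht0 ht1
      have := form_sub_const_of_notMem_sides hv hi his
      constructor <;> linarith
  · exact eventually_strict (strict_of_notMem_through hv hi)

/-- A point of a closed cell at which a generic functional is minimal is a vertex: otherwise it
could be moved along the hyperplanes through it in a direction in which the functional
decreases. -/
lemma IsLowest.dir_eq_bot (hℓ : IsGeneric E.form ℓ ⊤ Finset.univ) (h : E.IsLowest ℓ m v) :
    E.dir (𝓗.through {proj v}) = ⊥ := by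
  by_contra hne
  obtain ⟨u, hu, huℓ⟩ := hℓ _ (Finset.subset_univ _) hne
  have hu' := E.mem_dir.1 hu
  obtain ⟨t, ht, ht0⟩ := ((eventually_mem_closedCell (w := (-ℓ u) • u) h.1 fun i hi => by
    by_cases his : i ∈ E.sides m v
    · rw [signed_apply_of_mem his, map_smul, hu' i hi, smul_zero]
    · rw [signed_apply_of_notMem his, map_smul, hu' i hi, smul_zero, neg_zero]).and
    self_mem_nhdsWithin).exists
  have h1 := h.2 _ ht
  simp only [map_add, map_smul, smul_eq_mul] at h1
  have h2 : 0 < t * (ℓ u * ℓ u) := mul_pos ht0 (mul_self_pos.2 huℓ)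
  linarith

/-- The minimum of a generic functional on a closed cell is attained at one point only, as the
midpoint of two such points is a vertex. -/
lemma IsLowest.unique (hℓ : IsGeneric E.form ℓ ⊤ Finset.univ) (hv : E.IsLowest ℓ m v)
    (hw : E.IsLowest ℓ m w) : v = w := by
  set u : Fin n → ℝ := (1 / 2 : ℝ) • v + (1 / 2 : ℝ) • w with hu
  have hform : ∀ i, E.form i u = (1 / 2) * E.form i v + (1 / 2) * E.form i w := fun i => by
    simp [hu]
  have hul : E.IsLowest ℓ m u := by
    refine ⟨fun i => ?_, fun y hy => ?_⟩
    · rw [hform]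
      have h1 := hv.1 i
      have h2 := hw.1 i
      constructor <;> linarith
    · have h1 := hv.2 y hy
      have h2 := hw.2 y hy
      simp only [hu, map_add, map_smul, smul_eq_mul]
      linarith
  have hmem : v - w ∈ E.dir (𝓗.through {proj u}) := by
    refine E.mem_dir.2 fun i hi => ?_
    have h1 := hv.1 i
    have h2 := hw.1 i
    rw [map_sub]
    by_cases his : i ∈ E.sides m u
    · have := form_of_mem_sides his
      rw [hform] at this
      linarith
    · have := form_sub_const_of_notMem_sides hul.1 hi his
      rw [hform] at this
      linarith
  rw [hul.dir_eq_bot hℓ, Submodule.mem_bot] at hmem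
  exact sub_eq_zero.1 hmem

variable (m) in
/-- In an essential arrangement the closed cells are compact. -/
lemma isCompact_closedCell (hE : E.IsEssential) : IsCompact (E.closedCell m) := by
  let f : (Fin n → ℝ) →ₗ[ℝ] (𝓗.hyperplanes → ℝ) := LinearMap.pi E.form
  have hf : LinearMap.ker f = ⊥ := by
    rw [← hE]
    ext u
    simp [f, LinearMap.mem_ker, funext_iff, mem_dir]
  have h1 : E.closedCell m = f ⁻¹' Set.Icc (fun i => m i + E.const i)
      (fun i => m i + 1 + E.const i) := by
    ext x
    simp only [closedCell, Set.mem_ofPred_eq, Set.mem_preimage, Set.mem_Icc, Pi.le_def, f,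
      LinearMap.pi_apply, ← forall_and, le_sub_iff_add_le, sub_le_iff_le_add]
  rw [h1]
  exact (LinearMap.isClosedEmbedding_of_injective hf).isCompact_preimage isCompact_Icc

lemma exists_isLowest (hE : E.IsEssential) (ℓ : (Fin n → ℝ) →ₗ[ℝ] ℝ)
    (hm : (E.openCell m).Nonempty) : ∃ v, E.IsLowest ℓ m v := by
  obtain ⟨v, hv, hmin⟩ := (isCompact_closedCell m hE).exists_isMinOn
    (hm.mono (E.openCell_subset_closedCell m))
    (LinearMap.continuous_of_finiteDimensional ℓ).continuousOn
  exact ⟨v, hv, fun y hy => hmin hy⟩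

lemma IsLowest.add_latticeVec (h : E.IsLowest ℓ m v) (z : Fin n → ℤ) :
    E.IsLowest ℓ (m + E.shift z) (v + latticeVec z) := by
  refine ⟨E.add_latticeVec_mem_closedCell.2 h.1, fun y hy => ?_⟩
  have h1 := h.2 (y - latticeVec z)
    ((E.add_latticeVec_mem_closedCell (z := z)).1 (by simpa using hy))
  rw [map_sub] at h1
  rw [map_add]
  linarith

/-- The cone at its lowest vertex that a cell determines is positive. -/
lemma IsLowest.isPositiveCone (hℓ : IsGeneric E.form ℓ ⊤ Finset.univ) (h : E.IsLowest ℓ m v)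
    (hm : (E.openCell m).Nonempty) :
    IsPositiveCone (signed E.form (E.sides m v)) ℓ ⊤ (𝓗.through {proj v}) := by
  obtain ⟨x, hx⟩ := hm
  refine ⟨⟨x - v, trivial, fun i hi => signed_sub_pos h.1 hx hi⟩, fun w _ hw hw0 => ?_⟩
  obtain ⟨t, ht, ht0⟩ := ((eventually_mem_closedCell h.1 hw).and self_mem_nhdsWithin).exists
  have h1 := h.2 _ ht
  have ht0' : (0 : ℝ) < t := ht0
  by_contra! hle
  have h2 : E.IsLowest ℓ m (v + t • w) := by
    refine ⟨ht, fun y hy => (h.2 y hy).trans' ?_⟩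
    rw [map_add, map_smul, smul_eq_mul]
    linarith [mul_nonpos_of_nonneg_of_nonpos ht0'.le hle]
  have h3 := h.unique hℓ h2
  rw [left_eq_add] at h3
  exact (smul_ne_zero ht0'.ne' hw0) h3

variable (E v) in
open Classical in
/-- The index of the cell that has `v` in its closure and lies on the positive side of the
hyperplanes in `T` and on the negative side of the other hyperplanes through `proj v`. -/
def cellOf (T : Finset 𝓗.hyperplanes) (i : 𝓗.hyperplanes) : ℤ :=
  if i ∈ 𝓗.through {proj v} ∧ i ∉ T then E.cell v i - 1 else E.cell v i

lemma cellOf_sides (hv : v ∈ E.closedCell m) : E.cellOf v (E.sides m v) = m := by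
  ext i
  by_cases hi : i ∈ 𝓗.through {proj v}
  · have h1 := E.proj_mem_iff_cell.1 (mem_through_singleton.1 hi)
    by_cases his : i ∈ E.sides m v
    · have h2 := form_of_mem_sides his
      rw [← h1] at h2
      simp only [cellOf, hi, his, not_true, and_false, if_false]
      exact_mod_cast h2.symm
    · have h2 := form_sub_const_of_notMem_sides hv hi his
      rw [← h1] at h2
      have h3 : E.cell v i = m i + 1 := by exact_mod_cast h2
      simp [cellOf, hi, his, h3]
  · have h1 := strict_of_notMem_through hv hi
    simp only [cellOf, hi, false_and, if_false]
    exact Int.floor_eq_iff.2 ⟨h1.1.le, h1.2⟩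

lemma mem_closedCell_cellOf (T : Finset 𝓗.hyperplanes) : v ∈ E.closedCell (E.cellOf v T) := by
  intro i
  by_cases hi : i ∈ 𝓗.through {proj v} ∧ i ∉ T
  · have h1 := E.proj_mem_iff_cell.1 (mem_through_singleton.1 hi.1)
    simp only [cellOf, if_pos hi]
    push_cast
    constructor <;> linarith
  · simp only [cellOf, if_neg hi]
    exact ⟨Int.floor_le _, (Int.lt_floor_add_one _).le⟩

lemma sides_cellOf {T : Finset 𝓗.hyperplanes} (hT : T ⊆ 𝓗.through {proj v}) :
    E.sides (E.cellOf v T) v = T := by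
  ext i
  simp only [sides, Finset.mem_filter]
  constructor
  · rintro ⟨hi, h⟩
    by_contra hiT
    have h1 := E.proj_mem_iff_cell.1 (mem_through_singleton.1 hi)
    rw [← h1, cellOf, if_pos ⟨hi, hiT⟩] at h
    push_cast at h
    linarith
  · intro hi
    refine ⟨hT hi, ?_⟩
    rw [cellOf, if_neg fun h => h.2 hi]
    exact E.proj_mem_iff_cell.1 (mem_through_singleton.1 (hT hi))

/-- A positive cone at a point comes from a cell with this point as its lowest vertex. -/
lemma isLowest_cellOf {T : Finset 𝓗.hyperplanes} (hT : T ⊆ 𝓗.through {proj v})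
    (h : IsPositiveCone (signed E.form T) ℓ ⊤ (𝓗.through {proj v})) :
    E.IsLowest ℓ (E.cellOf v T) v ∧ (E.openCell (E.cellOf v T)).Nonempty := by
  have hv : v ∈ E.closedCell (E.cellOf v T) := mem_closedCell_cellOf T
  rw [← sides_cellOf hT] at h
  obtain ⟨⟨u, -, hu⟩, hpos⟩ := h
  refine ⟨⟨hv, fun y hy => ?_⟩, ?_⟩
  · by_cases hyv : y - v = 0
    · rw [sub_eq_zero.1 hyv]
    · have := hpos (y - v) trivial (fun i hi => signed_sub_nonneg hv hy hi) hyv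
      rw [map_sub] at this
      linarith
  · obtain ⟨t, ht⟩ := (eventually_mem_openCell hv hu).exists
    exact ⟨_, ht⟩

variable (E) in
lemma exists_isGeneric : ∃ ℓ : (Fin n → ℝ) →ₗ[ℝ] ℝ, IsGeneric E.form ℓ ⊤ Finset.univ := by
  have h : ∀ S : {S : Finset 𝓗.hyperplanes // E.dir S ≠ ⊥}, ∃ u ∈ E.dir S.1, u ≠ 0 := fun S =>
    Submodule.exists_mem_ne_zero_of_ne_bot S.2
  choose u hu hu0 using h
  obtain ⟨ℓ, hℓ⟩ := Module.exists_dual_forall_apply_ne_zero (K := ℝ) u hu0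
  exact ⟨ℓ, fun S _ hS => ⟨u ⟨S, hS⟩, hu ⟨S, hS⟩, hℓ ⟨S, hS⟩⟩⟩

/-! ### The number of regions -/

open Classical in
/-- The regions of an essential arrangement correspond to the pairs of a point of the intersection
poset and a positive chamber of the central arrangement at this point. -/
lemma finite_regions_and_ncard (hE : E.IsEssential) (hℓ : IsGeneric E.form ℓ ⊤ Finset.univ)
    (P : Finset (Torus n)) (hP : ∀ p, p ∈ P ↔ {p} ∈ 𝓗.flats) :
    𝓗.regions.Finite ∧ 𝓗.regions.ncard = ∑ p ∈ P, ((𝓗.through {p}).powerset.filter fun T =>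
      IsPositiveCone (signed E.form T) ℓ ⊤ (𝓗.through {p})).card := by
  let lift : Torus n → (Fin n → ℝ) := Function.surjInv proj_surjective
  have hlift : ∀ p, proj (lift p) = p := Function.surjInv_eq proj_surjective
  let Ω : Finset (Σ _ : Torus n, Finset 𝓗.hyperplanes) := P.sigma fun p =>
    (𝓗.through {p}).powerset.filter fun T =>
      IsPositiveCone (signed E.form T) ℓ ⊤ (𝓗.through {p})
  let Φ : (Σ _ : Torus n, Finset 𝓗.hyperplanes) → Set (Torus n) := fun x =>
    proj '' E.openCell (E.cellOf (lift x.1) x.2)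
  have hΩ : ∀ x ∈ Ω, x.2 ⊆ 𝓗.through {proj (lift x.1)} ∧
      IsPositiveCone (signed E.form x.2) ℓ ⊤ (𝓗.through {proj (lift x.1)}) := fun x hx => by
    have h1 := (Finset.mem_sigma.1 hx).2
    rw [Finset.mem_filter, Finset.mem_powerset] at h1
    rwa [hlift]
  have himage : 𝓗.regions = Φ '' Ω := by
    ext R
    constructor
    · intro hR
      obtain ⟨m, hm, rfl⟩ := E.mem_regions_iff.1 hR
      obtain ⟨w, hw⟩ := exists_isLowest hE ℓ hm
      -- Translate the cell so that its lowest vertex is the chosen lift.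
      obtain ⟨z, hz⟩ := proj_eq_proj_iff.1 (hlift (proj w))
      have hm' : (E.openCell (m + E.shift z)).Nonempty := by
        obtain ⟨x, hx⟩ := hm
        exact ⟨_, E.add_latticeVec_mem_openCell.2 hx⟩
      have hw' := hw.add_latticeVec z
      rw [← hz] at hw'
      refine ⟨⟨proj w, E.sides (m + E.shift z) (lift (proj w))⟩, Finset.mem_sigma.2 ⟨?_, ?_⟩, ?_⟩
      · exact (hP _).2 (E.singleton_mem_flats_iff.2 (hw.dir_eq_bot hℓ))
      · have h1 := sides_subset (E := E) (m := m + E.shift z) (v := lift (proj w))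
        have h2 := hw'.isPositiveCone hℓ hm'
        rw [hlift] at h1 h2
        exact Finset.mem_filter.2 ⟨Finset.mem_powerset.2 h1, h2⟩
      · simp only [Φ]
        rw [cellOf_sides hw'.1]
        exact ((E.image_openCell_eq_iff hm).2 ⟨z, rfl⟩).symm
    · rintro ⟨x, hx, rfl⟩
      obtain ⟨h1, h2⟩ := hΩ x hx
      exact E.mem_regions_iff.2 ⟨_, (isLowest_cellOf h1 h2).2, rfl⟩
  have hinj : Set.InjOn Φ Ω := by
    rintro ⟨p, T⟩ hx ⟨q, T'⟩ hy hxy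
    obtain ⟨h1, h2⟩ := hΩ _ hx
    obtain ⟨h1', h2'⟩ := hΩ _ hy
    dsimp only at h1 h2 h1' h2'
    obtain ⟨hl, hne⟩ := isLowest_cellOf h1 h2
    obtain ⟨hl', -⟩ := isLowest_cellOf h1' h2'
    obtain ⟨z, hz⟩ := (E.image_openCell_eq_iff hne).1 hxy
    dsimp only at hz
    have hzl := hl.add_latticeVec z
    rw [← hz] at hzl
    have hv : lift q = lift p + latticeVec z := hl'.unique hℓ hzl
    have hpq : p = q := by
      rw [← hlift p, ← hlift q, hv, proj_add_latticeVec]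
    subst hpq
    have hz0 : E.shift z = 0 := by
      ext i
      have h3 : latticeVec z = 0 := by simpa using hv
      have h4 := E.form_latticeVec_eq z i
      rw [h3, map_zero] at h4
      exact_mod_cast h4.symm
    rw [hz0, add_zero] at hz
    rw [← sides_cellOf h1, ← sides_cellOf h1', hz]
  rw [himage]
  refine ⟨Ω.finite_toSet.image Φ, ?_⟩
  rw [hinj.ncard_image, Set.ncard_coe_finset, Finset.card_sigma]

open Classical in
/-- The number of regions of an essential arrangement as a signed sum of values of the Möbius
function at the coatoms of the intersection poset. -/
theorem finite_regions_and_ncard_eq_sum (hE : E.IsEssential) :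
    𝓗.regions.Finite ∧ (𝓗.regions.ncard : ℤ) =
      ∑ x : 𝓗.IntersectionPoset with IsCoatom x, (-1) ^ n * posetMoebius ⊥ x := by
  obtain ⟨ℓ, hℓ⟩ := E.exists_isGeneric
  have hfin : {p : Torus n | {p} ∈ 𝓗.flats}.Finite :=
    𝓗.finite_flats.preimage Set.singleton_injective.injOn
  obtain ⟨h1, h2⟩ := finite_regions_and_ncard hE hℓ hfin.toFinset (by simp)
  refine ⟨h1, ?_⟩
  rw [h2, Nat.cast_sum]
  refine Finset.sum_bij (fun p hp => OrderDual.toDual ⟨{p}, by simpa using hp⟩) ?_ ?_ ?_ ?_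
  · intro p hp
    exact Finset.mem_filter.2 ⟨Finset.mem_univ _, (isCoatom_iff hE).2 ⟨p, rfl⟩⟩
  · intro p hp q hq h
    exact Set.singleton_injective (congrArg toSet h)
  · intro x hx
    obtain ⟨p, hp⟩ := (isCoatom_iff hE).1 (Finset.mem_filter.1 hx).2
    have hp' : {p} ∈ 𝓗.flats := hp ▸ toSet_mem_flats x
    exact ⟨p, by simpa using hp', toSet_injective hp.symm⟩
  · intro p hp
    rw [E.posetMoebius_point (p := p) rfl, Finset.card_filter]
    push_cast
    have h3 := sum_isPositiveCone E.form ℓ (𝓗.through {p}) ⊤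
      fun S _ => hℓ S (Finset.subset_univ S)
    rw [finrank_top, Module.finrank_fin_fun] at h3
    exact h3

end Equations

end ToricArrangement

end

theorem mainTheorem5 (n : ℕ) (𝓗 : ToricArrangement n) (h𝓗 : 𝓗.RegionsAreOpenBalls) :
    𝓗.regions.Finite ∧
    (𝓗.regions.ncard : ℤ) = (-1) ^ n * 𝓗.charPoly.eval 0 ∧
    Nonempty (GradeMinOrder ℕ 𝓗.IntersectionPoset) ∧
    (𝓗.regions.ncard : ℤ) = toricZaslavsky 𝓗.IntersectionPoset := by
  classical
  obtain ⟨E⟩ := 𝓗.nonempty_equations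
  have hE : E.IsEssential := E.isEssential h𝓗
  obtain ⟨hfin, hcard⟩ := ToricArrangement.Equations.finite_regions_and_ncard_eq_sum hE
  refine ⟨hfin, ?_, ⟨E.gradeMinOrder hE⟩, ?_⟩
  · rw [hcard, ← Finset.mul_sum, ToricArrangement.charPoly, Polynomial.eval_finsetSum]
    congr 1
    simp only [Polynomial.eval_mul, Polynomial.eval_C, Polynomial.eval_pow, Polynomial.eval_X,
      zero_pow_eq, mul_ite, mul_one, mul_zero]
    rw [← Finset.sum_filter, Finset.filter_filter]
    refine Finset.sum_congr (Finset.filter_congr fun x _ => ?_) fun _ _ => rfl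
    -- The points are the nonempty flats of toric dimension zero.
    rw [ToricArrangement.Equations.isCoatom_iff hE]
    constructor
    · rintro ⟨p, hp⟩
      exact ⟨by simp [hp],
        (E.toricDim_eq_zero_iff (ToricArrangement.toSet_mem_flats x) (by simp [hp])).2 hp⟩
    · rintro ⟨hne, h0⟩
      obtain ⟨p, hp⟩ := Set.nonempty_iff_ne_empty.2 hne
      exact ⟨p, (E.toricDim_eq_zero_iff (ToricArrangement.toSet_mem_flats x) hp).1 h0⟩
  · rw [hcard, toricZaslavsky]
    refine Finset.sum_congr (Finset.filter_congr fun x _ => Iff.rfl) fun x hx => ?_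
    obtain ⟨p, hp⟩ := (ToricArrangement.Equations.isCoatom_iff hE).1 (Finset.mem_filter.1 hx).2
    have hrank : posetRank x = n := by
      let _ := E.gradeMinOrder hE
      exact (ToricArr.posetRank_eq_grade x).trans (E.codim_point hp)
    rw [hrank]
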